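/- Fix $0<q<1$. Let $\mathbb A=\{z\in\mathbb C: q<|z|<1\}$, with boundary circles $B_1=\{|z|=1\}$ and $B_q=\{|z|=q\}$, $B=B_1\cup B_q$. Let $\mu_r$ be the multiple of arclength measure on $B_r$ of total mass $2\pi$ ($r\in\{1,q\}$) and $\mu=\mu_1+\mu_q$; $L^p$ means $L^p(B,\mu)$. Write $\chi(z)=z$. For $\alpha\in[0,1)$ let $H^2_\alpha(\mathbb A)$ be the Hardy space of index $\alpha$: it consists of the (multivalued) functions on $\mathbb A$ given by functions $F(r,t)$ that are holomorphic on the universal cover $\{(r,t): q<r<1,\ t\in\mathbb R\}$, $(r,t)\mapsto re^{it}$, of $\mathbb A$, satisfy $F(r,t+2\pi)=e^{2\pi i\alpha}F(r,t)$, and have $\sup_{q<r<1}\int_0^{2\pi}|F(r,t)|^2\,dt<\infty$. Through its boundary values (limits in quadratic mean on both circles, on the branch $0\le t<2\pi$) $H^2_\alpha(\mathbb A)$ is regarded as a closed subspace of $L^2(B)$; let $P_\alpha$ be the orthogonal projection of $L^2(B)$ onto it. For a real-valued $\phi\in L^\infty(B)$ let $T^\alpha_\phi f=P_\alpha(\phi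 f)$, $f\in H^2_\alpha(\mathbb A)$. A real number $\lambda$ is called an eigenvalue of $\phi$ relative to $A(\mathbb A)$ (the algebra of functions continuous on $\overline{\mathbb A}$ and analytic in $\mathbb A$) if there are $\alpha\in[0,1)$ and a nonzero $g\in H^2_\alpha(\mathbb A)$ with $T^\alpha_\phi g=\lambda g$. **Corollary.** Let $\phi\in L^\infty(B)$ be real-valued and let $m<0<M$ be such that either (i) $\operatorname{ess\,sup}_{B_q}\phi=m$ and $\operatorname{ess\,inf}_{B_1}\phi=M$, or (ii) $\operatorname{ess\,sup}_{B_1}\phi=m$ and $\operatorname{ess\,inf}_{B_q}\phi=M$. Then every $\lambda\in(m,M)$ is an eigenvalue of $\phi$ relative to $A(\mathbb A)$. In case (ii), whenever $\lambda\in(m,M)$, $\alpha\in[0,1)$ and $0\ne g\in H^2_\alpha(\mathbb A)$ satisfy $T^\alpha_\phi g=\lambda g$, there is a real $c<0$ with $(\phi-\lambda)|g|^2=c\log|\chi q^{-1/2}|$ $\mu$-almost everywhere on $B$. Further, $M$ is an eigenvalue of $\phi$ relative to $A(\mathbb A)$ if and only if $\dfrac{\log|\chi q^{-1/2}|}{\phi-M}\in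 L^1$, and $m$ is an eigenvalue of $\phi$ relative to $A(\mathbb A)$ if and only if $\dfrac{\log|\chi q^{-1/2}|}{\phi-m}\in L^1$. (Membership in $L^1$ includes that the denominator is nonzero $\mu$-almost everywhere.) -/

import Mathlib

open MeasureTheory Set Filter Topology
open scoped ENNReal NNReal

noncomputable section

namespace AnnulusToeplitz

/-- The parametrization `t ↦ r e^{it}` of the circle `B_r = {|z| = r}`. -/
def circlePt (r t : ℝ) : ℂ := (r : ℂ) * Complex.exp (t * Complex.I)

lemma continuous_circlePt (r : ℝ) : Continuous (circlePt r) := by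
  unfold circlePt; fun_prop

/-- One full turn, `0 ≤ t < 2π`, with the measure `dt` (total mass `2π`). -/
def turn : Measure ℝ := volume.restrict (Ico 0 (2 * Real.pi))

/-- The measure `μ_r`: the multiple of arclength on the circle `B_r` of total mass `2π`
(as a measure on `ℂ` carried by `B_r`). -/
def circleMeasure (r : ℝ) : Measure ℂ := turn.map (circlePt r)

/-- The measure `μ = μ_1 + μ_q` on the boundary `B = B_1 ∪ B_q` of the annulus
`q < |z| < 1`. -/
def bdryMeasure (q : ℝ) : Measure ℂ := circleMeasure 1 + circleMeasure q

/-- `L²(B)`. -/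
abbrev L2B (q : ℝ) : Type := Lp ℂ 2 (bdryMeasure q)

/-- Real-valued `L^∞(B)`. -/
abbrev LinftyB (q : ℝ) : Type := Lp ℝ ∞ (bdryMeasure q)

/-- Holomorphic functions on the universal cover
`{(r, t) : q < r < 1, t ∈ ℝ}`, `(r, t) ↦ r e^{it}`, of the annulus. The complex structure is the
one pulled back from the annulus; `w ↦ (exp (Re w), Im w)` is a biholomorphic map from the
vertical strip `log q < Re w < 0` onto the cover. -/
def HolomorphicOnCover (q : ℝ) (F : ℝ → ℝ → ℂ) : Prop :=
  DifferentiableOn ℂ (fun w : ℂ => F (Real.exp w.re) w.im) {w : ℂ | Real.log q < w.re ∧ w.re < 0}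

/-- `F (r, t + 2π) = e^{2πiα} F (r, t)`: the function `F` on the cover is modulus automorphic
of index `α`. (The zero function is allowed for every `α`.) -/
def HasIndex (q α : ℝ) (F : ℝ → ℝ → ℂ) : Prop :=
  ∀ r ∈ Ioo q 1, ∀ t : ℝ,
    F r (t + 2 * Real.pi) = Complex.exp (2 * Real.pi * Complex.I * α) * F r t

/-- The Hardy class of index `α`: holomorphic modulus automorphic functions of index `α` on the
cover whose square integral means over the circles `|z| = r`, `q < r < 1`, are bounded. -/
structure IsHardy (q α : ℝ) (F : ℝ → ℝ → ℂ) : Prop where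
  holo : HolomorphicOnCover q F
  index : HasIndex q α F
  bdd : ∃ C : ℝ≥0, ∀ r ∈ Ioo q 1, eLpNorm (F r) 2 turn ≤ C

/-- `g` is the boundary function of `F`: on each of the two boundary circles it is the limit in
the quadratic mean of `F (r, ·)`. The multivalued boundary function is recorded through its
branch `0 ≤ t < 2π`. -/
structure IsBoundaryFunction (q : ℝ) (F : ℝ → ℝ → ℂ) (g : ℂ → ℂ) : Prop where
  outer : Tendsto (fun r => eLpNorm (fun t => F r t - g (circlePt 1 t)) 2 turn) (𝓝[<] 1) (𝓝 0)
  inner : Tendsto (fun r => eLpNorm (fun t => F r t - g (circlePt q t)) 2 turn) (𝓝[>] q) (𝓝 0)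

lemma HolomorphicOnCover.continuous {q : ℝ} {F : ℝ → ℝ → ℂ} (hq : 0 < q)
    (h : HolomorphicOnCover q F) {r : ℝ} (hr : r ∈ Ioo q 1) : Continuous (F r) := by
  have hr0 : 0 < r := hq.trans hr.1
  have hc : Continuous fun t : ℝ => ((Real.log r : ℂ) + t * Complex.I) := by fun_prop
  have hm : ∀ t : ℝ, ((Real.log r : ℂ) + t * Complex.I) ∈
      {w : ℂ | Real.log q < w.re ∧ w.re < 0} := by
    intro t
    simpa using ⟨Real.log_lt_log hq hr.1, Real.log_neg hr0 hr.2⟩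
  have := h.continuousOn.comp_continuous hc hm
  have e : ((fun w : ℂ => F (Real.exp w.re) w.im) ∘ fun t : ℝ =>
      ((Real.log r : ℂ) + t * Complex.I)) = F r := by
    funext t
    have h1 : ((Real.log r : ℂ) + t * Complex.I).re = Real.log r := by simp
    have h2 : ((Real.log r : ℂ) + t * Complex.I).im = t := by simp
    simp only [Function.comp_apply, h1, h2, Real.exp_log hr0]
  rwa [e] at this

lemma aesm_comp {q : ℝ} (g : L2B q) :
    AEStronglyMeasurable (fun t => g (circlePt 1 t)) turn ∧
    AEStronglyMeasurable (fun t => g (circlePt q t)) turn := by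
  have h := (Lp.stronglyMeasurable g)
  exact ⟨(h.comp_measurable (continuous_circlePt 1).measurable).aestronglyMeasurable,
    (h.comp_measurable (continuous_circlePt q).measurable).aestronglyMeasurable⟩

lemma ae_bdry {q : ℝ} {p : ℂ → Prop} (h : ∀ᵐ z ∂(bdryMeasure q), p z) :
    (∀ᵐ t ∂turn, p (circlePt 1 t)) ∧ (∀ᵐ t ∂turn, p (circlePt q t)) := by
  rw [bdryMeasure, ae_add_measure_iff] at h
  exact ⟨ae_of_ae_map (continuous_circlePt 1).measurable.aemeasurable h.1,
    ae_of_ae_map (continuous_circlePt q).measurable.aemeasurable h.2⟩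

lemma IsHardy.add {q α : ℝ} (hq : 0 < q) {F G : ℝ → ℝ → ℂ} (hF : IsHardy q α F)
    (hG : IsHardy q α G) : IsHardy q α (fun r t => F r t + G r t) where
  holo := DifferentiableOn.add hF.holo hG.holo
  index := fun r hr t => by simp only [hF.index r hr, hG.index r hr, mul_add]
  bdd := by
    obtain ⟨C, hC⟩ := hF.bdd
    obtain ⟨D, hD⟩ := hG.bdd
    refine ⟨C + D, fun r hr => ?_⟩
    push_cast
    exact (eLpNorm_add_le (hF.holo.continuous hq hr).aestronglyMeasurable
      (hG.holo.continuous hq hr).aestronglyMeasurable (by norm_num)).trans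
      (add_le_add (hC r hr) (hD r hr))

lemma IsHardy.smul {q α : ℝ} (c : ℂ) {F : ℝ → ℝ → ℂ} (hF : IsHardy q α F) :
    IsHardy q α (fun r t => c * F r t) where
  holo := DifferentiableOn.const_mul hF.holo c
  index := fun r hr t => by simp only [hF.index r hr]; ring
  bdd := by
    obtain ⟨C, hC⟩ := hF.bdd
    refine ⟨‖c‖₊ * C, fun r hr => ?_⟩
    have : eLpNorm (c • F r) 2 turn = ‖c‖ₑ * eLpNorm (F r) 2 turn := eLpNorm_const_smul _ _ _ _
    calc eLpNorm (fun t => c * F r t) 2 turn = ‖c‖ₑ * eLpNorm (F r) 2 turn := this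
      _ ≤ _ := by
        push_cast
        exact mul_le_mul_right (hC r hr) _

lemma tendsto_add_aux {l : Filter ℝ} {F G : ℝ → ℝ → ℂ} {f g h : ℝ → ℂ}
    (hFc : ∀ᶠ r in l, Continuous (F r)) (hGc : ∀ᶠ r in l, Continuous (G r))
    (hf : AEStronglyMeasurable f turn) (hg : AEStronglyMeasurable g turn)
    (hh : ∀ᵐ t ∂turn, h t = f t + g t)
    (hF : Tendsto (fun r => eLpNorm (fun t => F r t - f t) 2 turn) l (𝓝 0))
    (hG : Tendsto (fun r => eLpNorm (fun t => G r t - g t) 2 turn) l (𝓝 0)) :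
    Tendsto (fun r => eLpNorm (fun t => F r t + G r t - h t) 2 turn) l (𝓝 0) := by
  refine tendsto_of_tendsto_of_tendsto_of_le_of_le' tendsto_const_nhds
    (by simpa using hF.add hG) (Eventually.of_forall fun _ => zero_le) ?_
  filter_upwards [hFc, hGc] with r h1 h2
  have e : eLpNorm (fun t => F r t + G r t - h t) 2 turn
      = eLpNorm ((fun t => F r t - f t) + fun t => G r t - g t) 2 turn := by
    refine eLpNorm_congr_ae ?_
    filter_upwards [hh] with t ht
    simp only [Pi.add_apply, ht]
    ring
  rw [e]
  exact eLpNorm_add_le (h1.aestronglyMeasurable.sub hf) (h2.aestronglyMeasurable.sub hg)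
    (by norm_num)

lemma tendsto_smul_aux {l : Filter ℝ} (c : ℂ) {F : ℝ → ℝ → ℂ} {f h : ℝ → ℂ}
    (hh : ∀ᵐ t ∂turn, h t = c * f t)
    (hF : Tendsto (fun r => eLpNorm (fun t => F r t - f t) 2 turn) l (𝓝 0)) :
    Tendsto (fun r => eLpNorm (fun t => c * F r t - h t) 2 turn) l (𝓝 0) := by
  have e : ∀ r, eLpNorm (fun t => c * F r t - h t) 2 turn
      = ‖c‖ₑ * eLpNorm (fun t => F r t - f t) 2 turn := by
    intro r
    rw [← eLpNorm_const_smul]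
    refine eLpNorm_congr_ae ?_
    filter_upwards [hh] with t ht
    simp only [Pi.smul_apply, smul_eq_mul, ht]
    ring
  simp_rw [e]
  simpa using ENNReal.Tendsto.const_mul hF (Or.inr (by simp : ‖c‖ₑ ≠ ∞))

/-- The subspace of `L²(B)` formed by the boundary functions of the Hardy class of index `α`. -/
def hardyBoundary (q : ℝ) (hq : q ∈ Ioo (0 : ℝ) 1) (α : ℝ) : Submodule ℂ (L2B q) where
  carrier := {g | ∃ F, IsHardy q α F ∧ IsBoundaryFunction q F g}
  zero_mem' := by
    refine ⟨fun _ _ => 0, ⟨differentiableOn_const _, fun _ _ _ => by simp, 0, fun r _ => ?_⟩,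
      ?_, ?_⟩
    · exact (eLpNorm_zero' (α := ℝ) (ε := ℂ)).le
    all_goals
      have h := ae_bdry (Lp.coeFn_zero ℂ 2 (bdryMeasure q))
      refine tendsto_const_nhds.congr fun r => ?_
      symm
      rw [← eLpNorm_zero' (α := ℝ) (ε := ℂ) (p := 2) (μ := turn)]
      refine eLpNorm_congr_ae ?_
    · filter_upwards [h.1] with t ht
      exact (congrArg (fun x : ℂ => 0 - x) ht).trans (by simp)
    · filter_upwards [h.2] with t ht
      exact (congrArg (fun x : ℂ => 0 - x) ht).trans (by simp)
  add_mem' := by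
    rintro f g ⟨F, hF, hFb⟩ ⟨G, hG, hGb⟩
    have h1 : ∀ᶠ r in 𝓝[<] (1 : ℝ), r ∈ Ioo q 1 := Ioo_mem_nhdsLT hq.2
    have h2 : ∀ᶠ r in 𝓝[>] q, r ∈ Ioo q 1 := Ioo_mem_nhdsGT hq.2
    have h := ae_bdry (Lp.coeFn_add f g)
    exact ⟨_, hF.add hq.1 hG,
      tendsto_add_aux (h1.mono fun r => hF.holo.continuous hq.1)
        (h1.mono fun r => hG.holo.continuous hq.1) (aesm_comp f).1 (aesm_comp g).1 h.1
        hFb.outer hGb.outer,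
      tendsto_add_aux (h2.mono fun r => hF.holo.continuous hq.1)
        (h2.mono fun r => hG.holo.continuous hq.1) (aesm_comp f).2 (aesm_comp g).2 h.2
        hFb.inner hGb.inner⟩
  smul_mem' := by
    rintro c f ⟨F, hF, hFb⟩
    have h := ae_bdry (Lp.coeFn_smul c f)
    exact ⟨_, hF.smul c, tendsto_smul_aux c h.1 hFb.outer, tendsto_smul_aux c h.2 hFb.inner⟩

/-- The Hilbert space `H²_α(𝔸)`, as a closed subspace of `L²(B)`. (The space of boundary functions
is already closed, so that taking the closure only records that fact.) -/
def H2 (q : ℝ) (hq : q ∈ Ioo (0 : ℝ) 1) (α : ℝ) : Submodule ℂ (L2B q) :=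
  (hardyBoundary q hq α).topologicalClosure

instance (q : ℝ) (hq : q ∈ Ioo (0 : ℝ) 1) (α : ℝ) : CompleteSpace (H2 q hq α) :=
  (Submodule.isClosed_topologicalClosure _).completeSpace_coe

/-- Multiplication by a symbol `φ ∈ L^∞(B)` on `L²(B)`. -/
def mulSymbol {q : ℝ} (φ : LinftyB q) : L2B q →L[ℂ] L2B q :=
  LinearMap.mkContinuous
    { toFun := fun g => (HSMul.hSMul φ g : L2B q)
      map_add' := fun f g => Lp.add_smul (𝕜 := ℝ) (E := ℂ) (p := ∞) (q := 2) (r := 2) φ f g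
      map_smul' := fun c g => by
        refine Lp.ext ?_
        filter_upwards [Lp.coeFn_lpSMul (r := 2) φ (c • g), Lp.coeFn_lpSMul (r := 2) φ g,
          Lp.coeFn_smul c g, Lp.coeFn_smul c (HSMul.hSMul φ g : L2B q)] with z h1 h2 h3 h4
        simp only [RingHom.id_apply, h1, h4, Pi.smul_apply, Pi.smul_apply', h2, h3]
        exact smul_comm _ _ _ }
    ‖φ‖ (fun g => Lp.norm_smul_le (𝕜 := ℝ) (E := ℂ) (p := ∞) (q := 2) (r := 2) φ g)

lemma coeFn_mulSymbol {q : ℝ} (φ : LinftyB q) (g : L2B q) :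
    mulSymbol φ g =ᵐ[bdryMeasure q] fun z => (φ z : ℂ) * g z := by
  filter_upwards [Lp.coeFn_lpSMul (r := 2) φ g] with z hz
  exact hz.trans (by simp)

/-- The Toeplitz operator `T^α_φ f = P_α (φ f)` on `H²_α(𝔸)`, where `P_α` is the orthogonal
projection of `L²(B)` onto `H²_α(𝔸)`. -/
def toeplitz (q : ℝ) (hq : q ∈ Ioo (0 : ℝ) 1) (α : ℝ) (φ : LinftyB q) :
    H2 q hq α →L[ℂ] H2 q hq α :=
  (H2 q hq α).orthogonalProjectionOnto ∘L mulSymbol φ ∘L (H2 q hq α).subtypeL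

/-- `lam` is an eigenvalue of `φ` relative to `A(𝔸)`: for some `α ∈ [0, 1)` there is a nonzero
`g ∈ H²_α(𝔸)` with `T^α_φ g = lam g`. -/
def IsEigenvalueRel (q : ℝ) (hq : q ∈ Ioo (0 : ℝ) 1) (φ : LinftyB q) (lam : ℝ) : Prop :=
  ∃ α ∈ Ico (0 : ℝ) 1, ∃ g : H2 q hq α, g ≠ 0 ∧ toeplitz q hq α φ g = (lam : ℂ) • g

/-- The function `log |χ q^{-1/2}|`, where `χ(z) = z`. -/
def logChi (q : ℝ) (z : ℂ) : ℝ := Real.log (‖z‖ * q ^ (-(1 / 2) : ℝ))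

end AnnulusToeplitz

end

noncomputable section

namespace AnnulusToeplitz

/-! Everything rests on the orthogonality of `(φ - λ) g` to `H²_α`, which is what `T g = λ g` means.

Necessity. The space `H²_α` is stable under multiplication by `z^n` for every integer `n`, so the
real function `h = (φ - λ)|g|²` on `B` is orthogonal to all `z^n`. Comparing these relations with
their complex conjugates kills every nonzero Fourier coefficient of `h` on each circle, because `q^n
≠ q^{-n}` for `n ≠ 0`; the case `n = 0` makes the two remaining constants opposite. Since `log|χ
q^{-1/2}|` is also constant on each circle, with opposite values, `h = c log|χ q^{-1/2}|`
(`exists_weight_eq`). If `c = 0`, then `g` vanishes on a circle where `φ ≠ λ`, hence everywhere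
(`eq_zero_of_ae_eq_zero`). So `c ≠ 0`, and `log|χ q^{-1/2}|/(φ - λ) = |g|²/c` is integrable. The
sign of `c` is read off on either circle.

Sufficiency. When `φ - λ` has opposite signs on the two circles, `w = ± log|χ q^{-1/2}|/(φ - λ)` is
a nonnegative weight for one choice of sign, and it is bounded below because `φ` is bounded. If `w`
is integrable, some zero-free `g` in some `H²_α` has `|g|² = w` on `B`, with `1/g` in the class of
index `-α` (`exists_outer_annulus`). For `x` in `H²_α` the integrand `(φ - λ) g x̄` is `±log|χ
q^{-1/2}|` times the conjugate of `x/g`. The function `x/g` is single-valued, so it has the same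
mean on both circles (`integral_mul_eq_of_coverLimit`), and the two contributions cancel.

The outer function on the annulus is glued from two outer functions of the disc, one per circle
(`exists_outer_disc`, proved by an orthogonal projection in the manner of Szegő), times the
exponential of an explicit Laurent series that repairs the modulus on the opposite circle
(`exists_correction`). The period of that series decides `α`, which is why `α` cannot be prescribed.

For `λ` strictly between `m` and `M` the quotient is bounded, so integrability is automatic; at the
endpoints it is exactly the stated condition. -/

/-! ### Fourier analysis on one turn of the circle. -/

instance : IsFiniteMeasure turn := by
  unfold turn; infer_instance

lemma turn_univ : turn univ = ENNReal.ofReal (2 * Real.pi) := by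
  simp [turn]

lemma integral_turn_eq (f : ℝ → ℂ) : ∫ t, f t ∂turn = ∫ t in (0 : ℝ)..2 * Real.pi, f t := by
  rw [intervalIntegral.integral_of_le Real.two_pi_pos.le, turn, integral_Ico_eq_integral_Ioc]

/-- The character `t ↦ e^{int}`. -/
def expi (n : ℤ) (t : ℝ) : ℂ := Complex.exp ((n : ℂ) * t * Complex.I)

lemma continuous_expi (n : ℤ) : Continuous (expi n) := by
  unfold expi; fun_prop

@[simp] lemma norm_expi (n : ℤ) (t : ℝ) : ‖expi n t‖ = 1 := by
  have : (n : ℂ) * t * Complex.I = ((n * t : ℝ) : ℂ) * Complex.I := by push_cast; ring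
  rw [expi, this, Complex.norm_exp_ofReal_mul_I]

lemma expi_add (m n : ℤ) (t : ℝ) : expi (m + n) t = expi m t * expi n t := by
  rw [expi, expi, expi, ← Complex.exp_add]; push_cast; ring_nf

@[simp] lemma expi_zero (t : ℝ) : expi 0 t = 1 := by simp [expi]

lemma conj_expi (n : ℤ) (t : ℝ) : (starRingEnd ℂ) (expi n t) = expi (-n) t := by
  rw [expi, expi, ← Complex.exp_conj]; simp

lemma circlePt_pow (r t : ℝ) (n : ℕ) : circlePt r t ^ n = (r : ℂ) ^ n * expi n t := by
  rw [circlePt, mul_pow, ← Complex.exp_nat_mul, expi]; push_cast; ring_nf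

lemma circlePt_zpow (r t : ℝ) (n : ℤ) : circlePt r t ^ n = (r : ℂ) ^ n * expi n t := by
  rw [circlePt, mul_zpow, ← Complex.exp_int_mul, expi]; ring_nf

lemma norm_circlePt {r : ℝ} (hr : 0 ≤ r) (t : ℝ) : ‖circlePt r t‖ = r := by
  simp [circlePt, Complex.norm_exp_ofReal_mul_I, abs_of_nonneg hr]

lemma integral_expi (n : ℤ) : ∫ t, expi n t ∂turn = if n = 0 then (2 * Real.pi : ℂ) else 0 := by
  rw [integral_turn_eq]
  split_ifs with h
  · subst h; simp
  · have hc : (n : ℂ) * Complex.I ≠ 0 := by simp [h]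
    have : ∀ t : ℝ, expi n t = Complex.exp ((n : ℂ) * Complex.I * t) := fun t => by
      rw [expi]; ring_nf
    simp_rw [this]
    rw [integral_exp_mul_complex hc]
    have h2 : (n : ℂ) * Complex.I * ((2 * Real.pi : ℝ) : ℂ) = n * (2 * Real.pi * Complex.I) := by
      push_cast; ring
    rw [h2, Complex.exp_int_mul_two_pi_mul_I]; simp

lemma memLp_expi (n : ℤ) (p : ℝ≥0∞) : MemLp (expi n) p turn :=
  MemLp.of_bound (continuous_expi n).aestronglyMeasurable 1 (by simp)

lemma integrable_mul_expi {h : ℝ → ℂ} (hh : Integrable h turn) (n : ℤ) :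
    Integrable (fun t => h t * expi n t) turn :=
  hh.mul_bdd (c := 1) (continuous_expi n).aestronglyMeasurable (by simp)

/-- Uniqueness of Fourier coefficients of integrable functions. -/
lemma ae_eq_zero_of_fourier {h : ℝ → ℂ} (hh : Integrable h turn)
    (h0 : ∀ n : ℤ, ∫ t, h t * expi n t ∂turn = 0) : h =ᵐ[turn] 0 := by
  have : Fact (0 < 2 * Real.pi) := ⟨Real.two_pi_pos⟩
  have hint : ∀ f : C(AddCircle (2 * Real.pi), ℂ),
      Integrable (fun t : ℝ => h t * f t) turn := fun f =>
    hh.mul_bdd (c := ‖f‖) (by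
      have : Continuous fun t : ℝ => f (t : AddCircle (2 * Real.pi)) :=
        f.continuous.comp (AddCircle.continuous_mk' _)
      exact this.aestronglyMeasurable) (Eventually.of_forall fun t => f.norm_coe_le_norm _)
  -- Integration against `h` is a bounded functional on continuous functions of the circle; it kills
  -- the characters, whose span is dense, so it is zero.
  let Φ : C(AddCircle (2 * Real.pi), ℂ) →L[ℂ] ℂ := LinearMap.mkContinuous
    { toFun := fun f => ∫ t : ℝ, h t * f t ∂turn
      map_add' := fun f g => by
        rw [← integral_add (hint f) (hint g)]; simp [mul_add]
      map_smul' := fun c f => by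
        rw [RingHom.id_apply, smul_eq_mul, ← integral_const_mul]
        congr 1; ext t; simp; ring }
    (∫ t, ‖h t‖ ∂turn) (fun f => by
      rw [← integral_mul_const]
      refine norm_integral_le_of_norm_le (hh.norm.mul_const _) (Eventually.of_forall fun t => ?_)
      rw [norm_mul]
      gcongr
      exact f.norm_coe_le_norm _)
  have hΦ : ∀ f, Φ f = ∫ t : ℝ, h t * f t ∂turn := fun f => rfl
  have hΦ0 : ∀ f, Φ f = 0 := by
    have h1 : Submodule.span ℂ (range (@fourier (2 * Real.pi))) ≤ LinearMap.ker Φ.toLinearMap := by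
      rw [Submodule.span_le]
      rintro _ ⟨n, rfl⟩
      change Φ _ = 0
      rw [hΦ, ← h0 n]
      congr 1; ext t
      rw [fourier_coe_apply, expi]
      congr 2
      have : (Real.pi : ℂ) ≠ 0 := by exact_mod_cast Real.pi_ne_zero
      push_cast; field_simp
    have h2 : (Submodule.span ℂ (range (@fourier (2 * Real.pi)))).topologicalClosure
        ≤ LinearMap.ker Φ.toLinearMap :=
      Submodule.topologicalClosure_minimal _ h1 Φ.isClosed_ker
    rw [span_fourier_closure_eq_top] at h2
    exact fun f => h2 (Submodule.mem_top)
  -- A test function supported in the open interval vanishes at both endpoints, hence descends to a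
  -- continuous function on the circle.
  have key : ∀ᵐ x ∂turn, x ∈ Ioo 0 (2 * Real.pi) → h x = 0 := by
    refine isOpen_Ioo.ae_eq_zero_of_integral_contDiff_smul_eq_zero
      (hh.locallyIntegrable.locallyIntegrableOn _) fun g gs _ gsupp => ?_
    have g0 : g 0 = 0 := by
      by_contra hg; exact (gsupp (subset_tsupport g hg)).1.ne rfl
    have g1 : g (2 * Real.pi) = 0 := by
      by_contra hg; exact (gsupp (subset_tsupport g hg)).2.ne rfl
    let f : C(AddCircle (2 * Real.pi), ℂ) :=
      ⟨AddCircle.liftIco (2 * Real.pi) 0 (fun t => (g t : ℂ)),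
        AddCircle.liftIco_continuous (by simp [g0, g1])
          (Complex.continuous_ofReal.comp gs.continuous).continuousOn⟩
    rw [← hΦ0 f, hΦ]
    rw [turn]
    refine setIntegral_congr_fun measurableSet_Ico fun t ht => ?_
    have : f (t : AddCircle (2 * Real.pi)) = g t :=
      AddCircle.liftIco_coe_apply (f := fun t => (g t : ℂ)) (by simpa using ht)
    simp only [this, Complex.real_smul]; ring
  have h3 : ∀ᵐ x ∂turn, x ∈ Ioo 0 (2 * Real.pi) := by
    rw [turn, restrict_Ico_eq_restrict_Ioc, ← restrict_Ioo_eq_restrict_Ioc]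
    exact ae_restrict_mem measurableSet_Ioo
  filter_upwards [key, h3] with x hx hx' using hx hx'

/-- The character `e^{int}` as an element of `L²(turn)`. -/
def expiLp (n : ℤ) : Lp ℂ 2 turn := (memLp_expi n 2).toLp

lemma coeFn_expiLp (n : ℤ) : expiLp n =ᵐ[turn] expi n := MemLp.coeFn_toLp _

lemma inner_expiLp (n : ℤ) (f : Lp ℂ 2 turn) :
    inner ℂ (expiLp n) f = ∫ t, f t * expi (-n) t ∂turn := by
  rw [L2.inner_def]
  refine integral_congr_ae ?_
  filter_upwards [coeFn_expiLp n] with t ht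
  rw [ht, RCLike.inner_apply, conj_expi]

lemma integrable_Lp (f : Lp ℂ 2 turn) : Integrable f turn :=
  (Lp.memLp f).integrable (by norm_num)

/-- The Fourier basis of `L²(turn)`. -/
def fourierBasisTurn : HilbertBasis ℤ ℂ (Lp ℂ 2 turn) :=
  HilbertBasis.mkOfOrthogonalEqBot
    (v := fun n => ((Real.sqrt (2 * Real.pi))⁻¹ : ℂ) • expiLp n)
    (by
      have hpos : (0 : ℝ) < 2 * Real.pi := Real.two_pi_pos
      rw [orthonormal_iff_ite]
      intro m n
      rw [inner_smul_left, inner_smul_right, inner_expiLp]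
      have : ∫ t, expiLp n t * expi (-m) t ∂turn = ∫ t, expi (n - m) t ∂turn := by
        refine integral_congr_ae ?_
        filter_upwards [coeFn_expiLp n] with t ht
        rw [ht, ← expi_add, sub_eq_add_neg]
      rw [this, integral_expi]
      by_cases h : m = n
      · subst h
        have hs : (Real.sqrt (2 * Real.pi) : ℂ) * Real.sqrt (2 * Real.pi) = 2 * Real.pi := by
          rw [← Complex.ofReal_mul, Real.mul_self_sqrt hpos.le]; push_cast; rfl
        have hs0 : (Real.sqrt (2 * Real.pi) : ℂ) ≠ 0 := by
          exact_mod_cast (Real.sqrt_pos.2 hpos).ne'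
        simp only [sub_self, if_true, ← hs, map_inv₀, Complex.conj_ofReal]
        field_simp
      · rw [if_neg h, if_neg (by omega)]; simp)
    (by
      rw [Submodule.eq_bot_iff]
      intro f hf
      rw [Submodule.mem_orthogonal] at hf
      have h1 : ∀ n : ℤ, ∫ t, f t * expi n t ∂turn = 0 := fun n => by
        have h2 := hf _ (Submodule.subset_span ⟨-n, rfl⟩)
        rw [inner_smul_left, inner_expiLp, neg_neg] at h2
        refine (mul_eq_zero.1 h2).resolve_left ?_
        simp [Real.sqrt_ne_zero'.2 Real.pi_pos]
      rw [Lp.eq_zero_iff_ae_eq_zero]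
      exact ae_eq_zero_of_fourier (integrable_Lp f) h1)

lemma inner_fourierBasisTurn (n : ℤ) (f : Lp ℂ 2 turn) :
    inner ℂ (fourierBasisTurn n) f
      = ((Real.sqrt (2 * Real.pi))⁻¹ : ℂ) * ∫ t, f t * expi (-n) t ∂turn := by
  rw [fourierBasisTurn, HilbertBasis.coe_mkOfOrthogonalEqBot, inner_smul_left, inner_expiLp]
  simp

/-- The `n`-th Fourier coefficient. -/
def fcoef (f : ℝ → ℂ) (n : ℤ) : ℂ := (2 * Real.pi : ℂ)⁻¹ * ∫ t, f t * expi (-n) t ∂turn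

lemma hasSum_norm_fcoef {f : ℝ → ℂ} (hf : MemLp f 2 turn) :
    HasSum (fun n => ‖fcoef f n‖ ^ 2) ((2 * Real.pi)⁻¹ * (eLpNorm f 2 turn).toReal ^ 2) := by
  have h := fourierBasisTurn.hasSum_inner_mul_inner hf.toLp hf.toLp
  have h2 : ∀ n, inner ℂ hf.toLp (fourierBasisTurn n) * inner ℂ (fourierBasisTurn n) hf.toLp
      = ((2 * Real.pi * ‖fcoef f n‖ ^ 2 : ℝ) : ℂ) := fun n => by
    rw [← inner_conj_symm, Complex.conj_mul', inner_fourierBasisTurn, fcoef]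
    have : ∫ t, (hf.toLp f : ℝ → ℂ) t * expi (-n) t ∂turn = ∫ t, f t * expi (-n) t ∂turn := by
      refine integral_congr_ae ?_
      filter_upwards [hf.coeFn_toLp] with t ht
      rw [ht]
    rw [this, norm_mul, norm_mul, norm_inv, norm_inv]
    have h3 : ‖Real.sqrt (2 * Real.pi)‖ ^ 2 = 2 * Real.pi := by
      rw [Real.norm_eq_abs, sq_abs, Real.sq_sqrt Real.two_pi_pos.le]
    have h4 : ‖(2 * Real.pi : ℂ)‖ = 2 * Real.pi := by
      rw [norm_mul, Complex.norm_real]; simp [abs_of_pos Real.pi_pos]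
    rw [h4]
    norm_cast
    rw [mul_pow, inv_pow, h3]
    have := Real.pi_pos
    field_simp
  simp_rw [h2, inner_self_eq_norm_sq_to_K] at h
  have h5 : HasSum (fun n => 2 * Real.pi * ‖fcoef f n‖ ^ 2) (‖hf.toLp‖ ^ 2) :=
    Complex.hasSum_ofReal.1 (by simpa using h)
  rw [Lp.norm_toLp] at h5
  have h6 := h5.mul_left (2 * Real.pi)⁻¹
  have h7 : ∀ n, (2 * Real.pi)⁻¹ * (2 * Real.pi * ‖fcoef f n‖ ^ 2) = ‖fcoef f n‖ ^ 2 := fun n => by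
    have := Real.pi_pos
    field_simp
  simpa only [h7] using h6

lemma norm_fcoef_le {f : ℝ → ℂ} (hf : MemLp f 2 turn) (n : ℤ) :
    ‖fcoef f n‖ ≤ (eLpNorm f 2 turn).toReal := by
  have h := le_hasSum (hasSum_norm_fcoef hf) n fun _ _ => by positivity
  have h1 : (2 * Real.pi)⁻¹ ≤ 1 := inv_le_one_of_one_le₀ (by linarith [Real.pi_gt_three])
  refine le_of_sq_le_sq (h.trans ?_) ENNReal.toReal_nonneg
  exact mul_le_of_le_one_left (by positivity) h1

lemma fcoef_sub {f g : ℝ → ℂ} (hf : Integrable f turn) (hg : Integrable g turn) (n : ℤ) :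
    fcoef (fun t => f t - g t) n = fcoef f n - fcoef g n := by
  simp only [fcoef, sub_mul]
  rw [integral_sub (integrable_mul_expi hf _) (integrable_mul_expi hg _), mul_sub]

/-! ### Holomorphic extension to the disc and convergence in quadratic mean. -/

/-- The holomorphic extension to the unit disc of a function on the circle all of whose negative
Fourier coefficients vanish. -/
def discExt (f : ℝ → ℂ) (z : ℂ) : ℂ := ∑' n : ℕ, fcoef f n * z ^ n

lemma summable_discExt {f : ℝ → ℂ} (hf : MemLp f 2 turn) {r : ℝ} (hr : r ∈ Ico (0 : ℝ) 1) :
    Summable fun n : ℕ => ‖fcoef f n‖ * r ^ n := by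
  refine Summable.of_nonneg_of_le (fun n => mul_nonneg (norm_nonneg _) (pow_nonneg hr.1 _))
    (fun n => mul_le_mul_of_nonneg_right (norm_fcoef_le hf n) (pow_nonneg hr.1 _))
    ((summable_geometric_of_lt_one hr.1 hr.2).mul_left _)

lemma differentiableOn_discExt {f : ℝ → ℂ} (hf : MemLp f 2 turn) :
    DifferentiableOn ℂ (discExt f) (Metric.ball 0 1) := by
  intro z hz
  obtain ⟨r, h1, h2⟩ := exists_between (mem_ball_zero_iff.1 hz)
  have hr : r ∈ Ico (0 : ℝ) 1 := ⟨(norm_nonneg z).trans h1.le, h2⟩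
  have : DifferentiableOn ℂ (discExt f) (Metric.ball 0 r) := by
    refine Complex.differentiableOn_tsum_of_summable_norm (summable_discExt hf hr)
      (fun n => by fun_prop) Metric.isOpen_ball fun n w hw => ?_
    rw [norm_mul, norm_pow]
    have := (mem_ball_zero_iff.1 hw).le
    gcongr
  exact (this.differentiableAt (Metric.isOpen_ball.mem_nhds
    (mem_ball_zero_iff.2 h1))).differentiableWithinAt

lemma circlePt_mem_ball {r : ℝ} (hr : r ∈ Ico (0 : ℝ) 1) (t : ℝ) :
    circlePt r t ∈ Metric.ball (0 : ℂ) 1 := by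
  rw [mem_ball_zero_iff, norm_circlePt hr.1]; exact hr.2

lemma continuous_comp_circlePt {F : ℂ → ℂ} (hF : ContinuousOn F (Metric.ball 0 1)) {r : ℝ}
    (hr : r ∈ Ico (0 : ℝ) 1) : Continuous fun t => F (circlePt r t) :=
  hF.comp_continuous (continuous_circlePt r) (circlePt_mem_ball hr)

lemma memLp_of_continuous {f : ℝ → ℂ} (hf : Continuous f) (p : ℝ≥0∞) : MemLp f p turn := by
  obtain ⟨C, hC⟩ := isCompact_Icc.exists_bound_of_continuousOn
    (hf.continuousOn (s := Icc 0 (2 * Real.pi)))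
  refine MemLp.of_bound hf.aestronglyMeasurable C ?_
  filter_upwards [ae_restrict_mem (μ := volume) (measurableSet_Ico (a := 0) (b := 2 * Real.pi))]
    with t ht using hC t (Ico_subset_Icc_self ht)

/-- Termwise integration of the power series. The exponent `k.natAbs` gives one formula for all `k`:
for negative `k` both sides are zero. -/
lemma fcoef_discExt {f : ℝ → ℂ} (hf : MemLp f 2 turn) (h0 : ∀ n : ℤ, n < 0 → fcoef f n = 0)
    {r : ℝ} (hr : r ∈ Ico (0 : ℝ) 1) (k : ℤ) :
    fcoef (fun t => discExt f (circlePt r t)) k = (r : ℂ) ^ k.natAbs * fcoef f k := by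
  have e1 : ∀ (n : ℕ) (t : ℝ), fcoef f n * circlePt r t ^ n * expi (-k) t
      = fcoef f n * r ^ n * expi (n - k) t := fun n t => by
    rw [circlePt_pow, sub_eq_add_neg, expi_add]; ring
  have h1 := hasSum_integral_of_summable_integral_norm (μ := turn)
    (F := fun (n : ℕ) t => fcoef f n * circlePt r t ^ n * expi (-k) t)
    (fun n => (memLp_of_continuous (((continuous_circlePt r).pow n |>.const_mul _).mul
      (continuous_expi _)) 1).integrable le_rfl) (by
      simp only [norm_mul, norm_pow, norm_circlePt hr.1, norm_expi, mul_one, integral_const]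
      exact (summable_discExt hf hr).const_smul _)
  have e2 : ∀ t, ∑' n : ℕ, fcoef f n * circlePt r t ^ n * expi (-k) t
      = discExt f (circlePt r t) * expi (-k) t := fun t => by
    rw [tsum_mul_right, discExt]
  simp_rw [e2, e1, integral_const_mul, integral_expi] at h1
  rw [fcoef, ← h1.tsum_eq]
  have hpi : (2 * Real.pi : ℂ) ≠ 0 := by
    exact_mod_cast Real.two_pi_pos.ne'
  rcases lt_or_ge k 0 with hk | hk
  · rw [h0 k hk, mul_zero]
    have : ∀ n : ℕ, (n : ℤ) - k ≠ 0 := fun n => by omega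
    simp [this]
  · lift k to ℕ using hk
    rw [tsum_eq_single k]
    · simp; field_simp
    · intro n hn
      have : (n : ℤ) - k ≠ 0 := by omega
      simp [this]

lemma eLpNorm_eq_of_fcoef {f : ℝ → ℂ} (hf : MemLp f 2 turn) :
    eLpNorm f 2 turn = ENNReal.ofReal (Real.sqrt (2 * Real.pi * ∑' n, ‖fcoef f n‖ ^ 2)) := by
  have h := (hasSum_norm_fcoef hf).tsum_eq
  have hp := Real.two_pi_pos
  rw [h, mul_inv_cancel_left₀ hp.ne', Real.sqrt_sq ENNReal.toReal_nonneg,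
    ENNReal.ofReal_toReal hf.eLpNorm_ne_top]

lemma eLpNorm_discExt_le {f : ℝ → ℂ} (hf : MemLp f 2 turn)
    (h0 : ∀ n : ℤ, n < 0 → fcoef f n = 0) {r : ℝ} (hr : r ∈ Ico (0 : ℝ) 1) :
    eLpNorm (fun t => discExt f (circlePt r t)) 2 turn ≤ eLpNorm f 2 turn := by
  have hm : MemLp (fun t => discExt f (circlePt r t)) 2 turn := memLp_of_continuous
    (continuous_comp_circlePt (differentiableOn_discExt hf).continuousOn hr) _
  rw [eLpNorm_eq_of_fcoef hf, eLpNorm_eq_of_fcoef hm]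
  refine ENNReal.ofReal_le_ofReal (Real.sqrt_le_sqrt
    (mul_le_mul_of_nonneg_left ?_ Real.two_pi_pos.le))
  refine Summable.tsum_le_tsum (fun k => ?_) (hasSum_norm_fcoef hm).summable
    (hasSum_norm_fcoef hf).summable
  rw [fcoef_discExt hf h0 hr, norm_mul, norm_pow, Complex.norm_real, Real.norm_of_nonneg hr.1]
  have h1 : r ^ k.natAbs ≤ 1 := pow_le_one₀ hr.1 hr.2.le
  have h2 : 0 ≤ r ^ k.natAbs := pow_nonneg hr.1 _
  exact pow_le_pow_left₀ (by positivity) (mul_le_of_le_one_left (by positivity) h1) 2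

/-- By Parseval the squared distance is `2π ∑ (1 - r^|k|)² |f̂(k)|²`, which tends to zero by
dominated convergence. -/
lemma tendsto_discExt {f : ℝ → ℂ} (hf : MemLp f 2 turn)
    (h0 : ∀ n : ℤ, n < 0 → fcoef f n = 0) :
    Tendsto (fun r => eLpNorm (fun t => discExt f (circlePt r t) - f t) 2 turn) (𝓝[<] 1)
      (𝓝 0) := by
  have hev : ∀ᶠ r : ℝ in 𝓝[<] 1, r ∈ Ico (0 : ℝ) 1 := Ico_mem_nhdsLT one_pos
  have hm : ∀ r ∈ Ico (0 : ℝ) 1, MemLp (fun t => discExt f (circlePt r t)) 2 turn := fun r hr =>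
    memLp_of_continuous
      (continuous_comp_circlePt (differentiableOn_discExt hf).continuousOn hr) _
  have e1 : ∀ r ∈ Ico (0 : ℝ) 1, ∀ k, ‖fcoef (fun t => discExt f (circlePt r t) - f t) k‖ ^ 2
      = (1 - r ^ k.natAbs) ^ 2 * ‖fcoef f k‖ ^ 2 := fun r hr k => by
    rw [fcoef_sub ((hm r hr).integrable (by norm_num)) (hf.integrable (by norm_num)),
      fcoef_discExt hf h0 hr, ← mul_pow]
    have : (r : ℂ) ^ k.natAbs * fcoef f k - fcoef f k
        = -(((1 - r ^ k.natAbs : ℝ) : ℂ) * fcoef f k) := by push_cast; ring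
    rw [this, norm_neg, norm_mul, Complex.norm_real, mul_pow, Real.norm_eq_abs, sq_abs, mul_pow]
  have lim : Tendsto (fun r : ℝ => ∑' k : ℤ, (1 - r ^ k.natAbs) ^ 2 * ‖fcoef f k‖ ^ 2) (𝓝[<] 1)
      (𝓝 (∑' k : ℤ, 0)) := by
    refine tendsto_tsum_of_dominated_convergence (hasSum_norm_fcoef hf).summable (fun k => ?_) ?_
    · have : Continuous fun r : ℝ => (1 - r ^ k.natAbs) ^ 2 * ‖fcoef f k‖ ^ 2 := by fun_prop
      have h := (this.tendsto 1).mono_left (nhdsWithin_le_nhds (s := Iio 1))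
      simpa using h
    · filter_upwards [hev] with r hr k
      have h1 : r ^ k.natAbs ≤ 1 := pow_le_one₀ hr.1 hr.2.le
      have h2 : 0 ≤ r ^ k.natAbs := pow_nonneg hr.1 _
      rw [Real.norm_of_nonneg (by positivity)]
      refine mul_le_of_le_one_left (by positivity) ?_
      nlinarith
  have lim2 : Tendsto (fun r : ℝ => ENNReal.ofReal (Real.sqrt (2 * Real.pi *
      ∑' k : ℤ, (1 - r ^ k.natAbs) ^ 2 * ‖fcoef f k‖ ^ 2))) (𝓝[<] 1) (𝓝 0) := by
    have := ENNReal.tendsto_ofReal ((lim.const_mul (2 * Real.pi)).sqrt)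
    simpa using this
  refine lim2.congr' ?_
  filter_upwards [hev] with r hr
  rw [eLpNorm_eq_of_fcoef (f := fun t => discExt f (circlePt r t) - f t) ((hm r hr).sub hf)]
  simp_rw [← e1 r hr]

lemma eLpNorm_mul_le_two {f g : ℝ → ℂ} (hf : AEStronglyMeasurable f turn)
    (hg : AEStronglyMeasurable g turn) :
    eLpNorm (fun t => f t * g t) 1 turn ≤ eLpNorm f 2 turn * eLpNorm g 2 turn := by
  have : ENNReal.HolderTriple 2 2 1 := inferInstance
  have h := eLpNorm_smul_le_mul_eLpNorm (p := 2) (q := 2) (r := 1) hg hf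
  exact h

lemma eLpNorm_mul_expi (f : ℝ → ℂ) (n : ℤ) (p : ℝ≥0∞) :
    eLpNorm (fun t => f t * expi n t) p turn = eLpNorm f p turn :=
  eLpNorm_congr_norm_ae (by simp)

lemma memLp_mul_expi {f : ℝ → ℂ} {p : ℝ≥0∞} (hf : MemLp f p turn) (n : ℤ) :
    MemLp (fun t => f t * expi n t) p turn :=
  ⟨hf.1.mul (continuous_expi n).aestronglyMeasurable, by rw [eLpNorm_mul_expi]; exact hf.2⟩

/-- Products of two families converging in `L²` converge in `L¹`, by Hölder. This is how boundary
values of products are reached without a theory of `H¹`. -/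
lemma tendsto_integral_mul {l : Filter ℝ} {F G : ℝ → ℝ → ℂ} {f g : ℝ → ℂ}
    (hFm : ∀ᶠ r in l, MemLp (F r) 2 turn) (hGm : ∀ᶠ r in l, MemLp (G r) 2 turn)
    (hf : MemLp f 2 turn) (hg : MemLp g 2 turn)
    (hF : Tendsto (fun r => eLpNorm (fun t => F r t - f t) 2 turn) l (𝓝 0))
    (hG : Tendsto (fun r => eLpNorm (fun t => G r t - g t) 2 turn) l (𝓝 0)) :
    Tendsto (fun r => ∫ t, F r t * G r t ∂turn) l (𝓝 (∫ t, f t * g t ∂turn)) := by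
  have hi : ∀ {u v : ℝ → ℂ}, MemLp u 2 turn → MemLp v 2 turn →
      Integrable (fun t => u t * v t) turn := fun hu hv => hu.integrable_mul hv
  refine tendsto_integral_of_L1' _ (hi hf hg).1 ?_ ?_
  · filter_upwards [hFm, hGm] with r h1 h2 using hi h1 h2
  · have hlim : Tendsto (fun r => eLpNorm (fun t => F r t - f t) 2 turn
          * eLpNorm (fun t => G r t - g t) 2 turn
        + eLpNorm (fun t => F r t - f t) 2 turn * eLpNorm g 2 turn
        + eLpNorm f 2 turn * eLpNorm (fun t => G r t - g t) 2 turn) l (𝓝 0) := by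
      have h1 := ENNReal.Tendsto.mul hF (Or.inr ENNReal.zero_ne_top) hG
        (Or.inr ENNReal.zero_ne_top)
      have h2 := ENNReal.Tendsto.mul_const hF (Or.inr hg.eLpNorm_ne_top)
      have h3 := ENNReal.Tendsto.const_mul hG (Or.inr hf.eLpNorm_ne_top)
      simpa using (h1.add h2).add h3
    refine tendsto_of_tendsto_of_tendsto_of_le_of_le' tendsto_const_nhds hlim
      (Eventually.of_forall fun _ => zero_le) ?_
    filter_upwards [hFm, hGm] with r h1 h2
    have hFf := (h1.sub hf).1
    have hGg := (h2.sub hg).1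
    have e : ((fun t => F r t * G r t) - fun t => f t * g t)
        = ((fun t => (F r t - f t) * (G r t - g t)) + fun t => (F r t - f t) * g t)
          + fun t => f t * (G r t - g t) := by
      ext t; simp only [Pi.sub_apply, Pi.add_apply]; ring
    rw [e]
    refine (eLpNorm_add_le ((hFf.mul hGg).add (hFf.mul hg.1)) (hf.1.mul hGg) le_rfl).trans
      (add_le_add ((eLpNorm_add_le (hFf.mul hGg) (hFf.mul hg.1) le_rfl).trans
        (add_le_add ?_ ?_)) ?_)
    · exact eLpNorm_mul_le_two hFf hGg
    · exact eLpNorm_mul_le_two hFf hg.1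
    · exact eLpNorm_mul_le_two hf.1 hGg

lemma tendsto_integral_mul_expi {l : Filter ℝ} {F G : ℝ → ℝ → ℂ} {f g : ℝ → ℂ}
    (hFm : ∀ᶠ r in l, MemLp (F r) 2 turn) (hGm : ∀ᶠ r in l, MemLp (G r) 2 turn)
    (hf : MemLp f 2 turn) (hg : MemLp g 2 turn)
    (hF : Tendsto (fun r => eLpNorm (fun t => F r t - f t) 2 turn) l (𝓝 0))
    (hG : Tendsto (fun r => eLpNorm (fun t => G r t - g t) 2 turn) l (𝓝 0)) (n : ℤ) :
    Tendsto (fun r => ∫ t, F r t * G r t * expi n t ∂turn) l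
      (𝓝 (∫ t, f t * g t * expi n t ∂turn)) := by
  simp_rw [mul_assoc]
  refine tendsto_integral_mul hFm (hGm.mono fun r h => memLp_mul_expi h n) hf (memLp_mul_expi hg n) hF ?_
  simpa only [← sub_mul, eLpNorm_mul_expi] using hG

/-! ### Independence of the circle of integration, and Hardy functions of the disc. -/

/-- Cauchy's theorem for a periodic holomorphic function on a vertical strip: the mean over a
period does not depend on the vertical line. -/
lemma integral_vertical_eq {a b : ℝ} {G : ℂ → ℂ}
    (hG : DifferentiableOn ℂ G {w : ℂ | a < w.re ∧ w.re < b})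
    (hper : ∀ x ∈ Ioo a b, G (x + (2 * Real.pi : ℝ) * Complex.I) = G x)
    {x y : ℝ} (hx : x ∈ Ioo a b) (hy : y ∈ Ioo a b) :
    ∫ t : ℝ, G (x + t * Complex.I) ∂turn = ∫ t : ℝ, G (y + t * Complex.I) ∂turn := by
  have h := Complex.integral_boundary_rect_eq_zero_of_differentiableOn G (x : ℂ)
    (y + (2 * Real.pi : ℝ) * Complex.I) (hG.mono ?_)
  · rw [integral_turn_eq, integral_turn_eq]
    have e : (y + (2 * Real.pi : ℝ) * Complex.I : ℂ).im = 2 * Real.pi := by simp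
    have e' : (y + (2 * Real.pi : ℝ) * Complex.I : ℂ).re = y := by simp
    -- Periodicity makes the two horizontal sides of the rectangle cancel.
    have e1 : ∫ u in x..y, G (u + (2 * Real.pi : ℝ) * Complex.I) = ∫ u in x..y, G u := by
      refine intervalIntegral.integral_congr fun u hu => hper u ?_
      exact (convex_Ioo a b).ordConnected.uIcc_subset hx hy hu
    rw [e, e', Complex.ofReal_re, Complex.ofReal_im, e1] at h
    simp only [Complex.ofReal_zero, zero_mul, add_zero, sub_self, zero_add, ← smul_sub,
      smul_eq_zero, Complex.I_ne_zero, false_or] at h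
    exact (sub_eq_zero.1 h).symm
  · intro w hw
    have := hw.1
    simp only [mem_preimage, Complex.add_re, Complex.ofReal_re, Complex.mul_re, Complex.I_re,
      Complex.ofReal_im, Complex.I_im, mul_zero, mul_one, sub_self, add_zero] at this
    exact (convex_Ioo a b).ordConnected.uIcc_subset hx hy this

/-- `A` is holomorphic in the unit disc with square integrable boundary function `a`. -/
structure DiscLimit (A : ℂ → ℂ) (a : ℝ → ℂ) : Prop where
  holo : DifferentiableOn ℂ A (Metric.ball 0 1)
  memLp : MemLp a 2 turn
  bdd : ∀ r ∈ Ico (0 : ℝ) 1, eLpNorm (fun t => A (circlePt r t)) 2 turn ≤ eLpNorm a 2 turn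
  lim : Tendsto (fun r => eLpNorm (fun t => A (circlePt r t) - a t) 2 turn) (𝓝[<] 1) (𝓝 0)

lemma DiscLimit.memLp_circle {A : ℂ → ℂ} {a : ℝ → ℂ} (h : DiscLimit A a) {r : ℝ}
    (hr : r ∈ Ico (0 : ℝ) 1) (p : ℝ≥0∞) : MemLp (fun t => A (circlePt r t)) p turn :=
  memLp_of_continuous (continuous_comp_circlePt h.holo.continuousOn hr) p

lemma discLimit_discExt {f : ℝ → ℂ} (hf : MemLp f 2 turn)
    (h0 : ∀ n : ℤ, 0 < n → ∫ t, f t * expi n t ∂turn = 0) : DiscLimit (discExt f) f := by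
  have h1 : ∀ n : ℤ, n < 0 → fcoef f n = 0 := fun n hn => by
    rw [fcoef, h0 (-n) (by omega), mul_zero]
  exact ⟨differentiableOn_discExt hf, hf, fun r hr => eLpNorm_discExt_le hf h1 hr,
    tendsto_discExt hf h1⟩

lemma circlePt_eq_exp {r : ℝ} (hr : 0 < r) (t : ℝ) :
    circlePt r t = Complex.exp (Real.log r + t * Complex.I) := by
  rw [Complex.exp_add, ← Complex.ofReal_exp, Real.exp_log hr, circlePt]

lemma eq_zero_of_ae_turn {f : ℝ → ℂ} (hf : Continuous f) (h : f =ᵐ[turn] 0) {t : ℝ}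
    (ht : t ∈ Ico 0 (2 * Real.pi)) : f t = 0 := by
  have h2 : f =ᵐ[volume.restrict (Ioo 0 (2 * Real.pi))] 0 := by
    rw [turn, restrict_Ico_eq_restrict_Ioc, ← restrict_Ioo_eq_restrict_Ioc] at h
    exact h
  have h3 := Measure.eqOn_open_of_ae_eq h2 isOpen_Ioo hf.continuousOn continuousOn_const
  have h4 := h3.closure hf continuous_const
  rw [closure_Ioo Real.two_pi_pos.ne] at h4
  exact h4 (Ico_subset_Icc_self ht)

lemma exists_circlePt (z : ℂ) : ∃ t ∈ Ico 0 (2 * Real.pi), z = circlePt ‖z‖ t := by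
  refine ⟨toIcoMod Real.two_pi_pos 0 z.arg, by simpa using toIcoMod_mem_Ico Real.two_pi_pos 0 _, ?_⟩
  have h := toIcoMod_add_toIcoDiv_zsmul Real.two_pi_pos 0 z.arg
  rw [circlePt]
  conv_lhs => rw [← Complex.norm_mul_exp_arg_mul_I z]
  congr 1
  rw [Complex.exp_eq_exp_iff_exists_int]
  refine ⟨toIcoDiv Real.two_pi_pos 0 z.arg, ?_⟩
  conv_lhs => rw [← h]
  push_cast [zsmul_eq_mul]; ring

/-- If the product of the boundary functions is `1`, so is the product inside. -/
lemma DiscLimit.mul_eq_one {A B : ℂ → ℂ} {a b : ℝ → ℂ} (hA : DiscLimit A a) (hB : DiscLimit B b)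
    (hab : ∀ᵐ t ∂turn, a t * b t = 1) {z : ℂ} (hz : z ∈ Metric.ball (0 : ℂ) 1) :
    A z * B z = 1 := by
  have hQ : DifferentiableOn ℂ (fun z => A z * B z) (Metric.ball 0 1) := hA.holo.mul hB.holo
  have hev : ∀ᶠ r : ℝ in 𝓝[<] 1, r ∈ Ioo (0 : ℝ) 1 := Ioo_mem_nhdsLT one_pos
  -- On `|z| = r`, the product has the Fourier coefficients of the constant `1`: the mean of `A B
  -- z^n` is independent of the radius and can be evaluated in the limit at the boundary.
  have hco : ∀ r ∈ Ioo (0 : ℝ) 1, ∀ n : ℤ,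
      ∫ t, A (circlePt r t) * B (circlePt r t) * expi n t ∂turn
        = (r : ℂ) ^ (-n) * ∫ t, expi n t ∂turn := by
    intro r hr n
    let G : ℂ → ℂ := fun w => A (Complex.exp w) * B (Complex.exp w) * Complex.exp (n * w)
    have hG : ∀ x ∈ Ioo (0 : ℝ) 1, ∀ t : ℝ, G (Real.log x + t * Complex.I)
        = (x : ℂ) ^ n * (A (circlePt x t) * B (circlePt x t) * expi n t) := fun x hx t => by
      simp only [G]
      rw [← circlePt_eq_exp hx.1, Complex.exp_int_mul, ← circlePt_eq_exp hx.1, circlePt_zpow]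
      ring
    -- Subtracting `1` only serves to put the line `Re w = log r` inside the open strip.
    have hmap : MapsTo Complex.exp {w : ℂ | Real.log r - 1 < w.re ∧ w.re < 0}
        (Metric.ball 0 1) := fun w hw => by
      rw [mem_ball_zero_iff, Complex.norm_exp]; exact Real.exp_lt_one_iff.2 hw.2
    have hGd : DifferentiableOn ℂ G {w : ℂ | Real.log r - 1 < w.re ∧ w.re < 0} :=
      (hQ.comp Complex.differentiable_exp.differentiableOn hmap).mul (by fun_prop)
    have hper : ∀ x ∈ Ioo (Real.log r - 1) 0, G (x + (2 * Real.pi : ℝ) * Complex.I) = G x := by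
      intro x _
      have e1 : Complex.exp (x + (2 * Real.pi : ℝ) * Complex.I) = Complex.exp x := by
        push_cast; exact Complex.exp_periodic _
      simp only [G, Complex.exp_int_mul, e1]
    have hlog : Real.log r < 0 := Real.log_neg hr.1 hr.2
    have hconst : ∀ x ∈ Ioo r 1, (x : ℂ) ^ n *
        ∫ t, A (circlePt x t) * B (circlePt x t) * expi n t ∂turn
          = (r : ℂ) ^ n * ∫ t, A (circlePt r t) * B (circlePt r t) * expi n t ∂turn := by
      intro x hx
      have hx0 : 0 < x := hr.1.trans hx.1
      have := integral_vertical_eq hGd hper (x := Real.log x) (y := Real.log r)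
        ⟨by linarith [Real.log_lt_log hr.1 hx.1], Real.log_neg hx0 hx.2⟩ ⟨by linarith, hlog⟩
      simp_rw [hG x ⟨hx0, hx.2⟩, hG r hr, integral_const_mul] at this
      exact this
    have hlim := tendsto_integral_mul_expi
      (hev.mono fun r hr => hA.memLp_circle ⟨hr.1.le, hr.2⟩ 2)
      (hev.mono fun r hr => hB.memLp_circle ⟨hr.1.le, hr.2⟩ 2) hA.memLp hB.memLp hA.lim hB.lim n
    have hone : ∫ t, a t * b t * expi n t ∂turn = ∫ t, expi n t ∂turn := by
      refine integral_congr_ae ?_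
      filter_upwards [hab] with t ht
      rw [ht, one_mul]
    have hpow : Tendsto (fun x : ℝ => (x : ℂ) ^ n) (𝓝[<] 1) (𝓝 1) := by
      have : ContinuousAt (fun x : ℝ => (x : ℂ) ^ n) 1 :=
        Complex.continuous_ofReal.continuousAt.zpow₀ n (Or.inl (by simp))
      simpa using this.tendsto.mono_left (nhdsWithin_le_nhds (s := Iio 1))
    have hl := (hpow.mul hlim)
    rw [one_mul, hone] at hl
    have h2 : Tendsto (fun x : ℝ => (x : ℂ) ^ n *
        ∫ t, A (circlePt x t) * B (circlePt x t) * expi n t ∂turn) (𝓝[<] 1)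
        (𝓝 ((r : ℂ) ^ n * ∫ t, A (circlePt r t) * B (circlePt r t) * expi n t ∂turn)) :=
      tendsto_const_nhds.congr' (by
        filter_upwards [Ioo_mem_nhdsLT hr.2] with x hx using (hconst x hx).symm)
    have h3 := tendsto_nhds_unique h2 hl
    have hr0 : (r : ℂ) ≠ 0 := by exact_mod_cast hr.1.ne'
    rw [← h3, zpow_neg, inv_mul_cancel_left₀ (zpow_ne_zero n hr0)]
  have hcirc : ∀ r ∈ Ioo (0 : ℝ) 1, ∀ t ∈ Ico 0 (2 * Real.pi),
      A (circlePt r t) * B (circlePt r t) = 1 := by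
    intro r hr t ht
    have hc : Continuous fun t => A (circlePt r t) * B (circlePt r t) - 1 :=
      (continuous_comp_circlePt hQ.continuousOn ⟨hr.1.le, hr.2⟩).sub continuous_const
    have hi := (memLp_of_continuous hc 1).integrable le_rfl
    refine sub_eq_zero.1 (eq_zero_of_ae_turn hc (ae_eq_zero_of_fourier hi fun n => ?_) ht)
    have h1 : Integrable (fun t => A (circlePt r t) * B (circlePt r t)) turn :=
      (memLp_of_continuous (continuous_comp_circlePt hQ.continuousOn ⟨hr.1.le, hr.2⟩)
        1).integrable le_rfl
    simp_rw [sub_mul, one_mul]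
    rw [integral_sub (integrable_mul_expi h1 n) ((memLp_expi n 1).integrable le_rfl),
      hco r hr n, integral_expi]
    split_ifs with h
    · subst h; simp
    · simp
  have hpt : ∀ z ∈ Metric.ball (0 : ℂ) 1, z ≠ 0 → A z * B z = 1 := by
    intro z hz hz0
    obtain ⟨t, ht, e⟩ := exists_circlePt z
    rw [e]
    exact hcirc _ ⟨norm_pos_iff.2 hz0, mem_ball_zero_iff.1 hz⟩ t ht
  -- The coordinate `w = log z` misses the centre, which is recovered by continuity.
  rcases eq_or_ne z 0 with rfl | hz0
  · have hc : ContinuousAt (fun z => A z * B z) 0 :=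
      hQ.continuousOn.continuousAt (Metric.ball_mem_nhds 0 one_pos)
    have h1 := hc.tendsto.mono_left (nhdsWithin_le_nhds (s := {0}ᶜ))
    have h2 : Tendsto (fun z => A z * B z) (𝓝[≠] 0) (𝓝 1) := by
      refine tendsto_const_nhds.congr' ?_
      filter_upwards [self_mem_nhdsWithin,
        mem_nhdsWithin_of_mem_nhds (Metric.ball_mem_nhds (0 : ℂ) one_pos)] with z h1 h2
      exact (hpt z h2 h1).symm
    exact tendsto_nhds_unique h1 h2
  · exact hpt z hz hz0

/-! ### Outer functions on the disc. -/

lemma memLp_conj {f : ℝ → ℂ} {p : ℝ≥0∞} (hf : MemLp f p turn) :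
    MemLp (fun t => (starRingEnd ℂ) (f t)) p turn :=
  ⟨Complex.continuous_conj.comp_aestronglyMeasurable hf.1, by
    rw [eLpNorm_congr_norm_ae (g := f) (by simp)]; exact hf.2⟩

lemma inner_toLp {f g : ℝ → ℂ} (hf : MemLp f 2 turn) (hg : MemLp g 2 turn) :
    inner ℂ (hf.toLp f) (hg.toLp g) = ∫ t, g t * (starRingEnd ℂ) (f t) ∂turn := by
  rw [L2.inner_def]
  refine integral_congr_ae ?_
  filter_upwards [hf.coeFn_toLp, hg.coeFn_toLp] with t h1 h2
  rw [h1, h2, RCLike.inner_apply]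

/-- An integrable real function on the circle whose positive Fourier coefficients vanish is
constant. -/
lemma ae_eq_const_of_fourier {h : ℝ → ℝ} (hh : Integrable h turn)
    (h0 : ∀ n : ℤ, 0 < n → ∫ t, (h t : ℂ) * expi n t ∂turn = 0) :
    ∃ c : ℝ, c = (2 * Real.pi)⁻¹ * ∫ t, h t ∂turn ∧ h =ᵐ[turn] fun _ => c := by
  refine ⟨_, rfl, ?_⟩
  set c : ℝ := (2 * Real.pi)⁻¹ * ∫ t, h t ∂turn with hc
  have hi : Integrable (fun t => (h t : ℂ)) turn := hh.ofReal
  have hneg : ∀ n : ℤ, n ≠ 0 → ∫ t, (h t : ℂ) * expi n t ∂turn = 0 := by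
    intro n hn
    -- Since `h` is real, its coefficients at `n` and `-n` are conjugate.
    rcases lt_or_gt_of_ne hn with h1 | h1
    · have h2 := congrArg (starRingEnd ℂ) (h0 (-n) (by omega))
      rw [← integral_conj, map_zero] at h2
      simpa [conj_expi] using h2
    · exact h0 n h1
  have hz : (fun t => (h t : ℂ) - c) =ᵐ[turn] 0 := by
    refine ae_eq_zero_of_fourier (hi.sub (integrable_const _)) fun n => ?_
    simp_rw [sub_mul]
    rw [integral_sub (integrable_mul_expi hi n) (((memLp_expi n 1).integrable le_rfl).const_mul _),
      integral_const_mul, integral_expi]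
    split_ifs with hn
    · subst hn
      simp only [expi_zero, mul_one]
      rw [integral_complex_ofReal, hc]
      have : (Real.pi : ℂ) ≠ 0 := by exact_mod_cast Real.pi_ne_zero
      push_cast; field_simp; ring
    · rw [hneg n hn]; ring
  filter_upwards [hz] with t ht
  have : (h t : ℂ) = c := sub_eq_zero.1 ht
  exact_mod_cast this

/-- Szegő: an integrable weight on the circle bounded below is the squared modulus of the boundary
function of a holomorphic function in the Hardy space of the disc whose reciprocal is there too. -/
lemma exists_outer_disc {w : ℝ → ℝ} (hw : Integrable w turn) {ε : ℝ} (hε : 0 < ε)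
    (hwε : ∀ᵐ t ∂turn, ε ≤ w t) :
    ∃ K P : ℂ → ℂ, ∃ k p : ℝ → ℂ, DiscLimit K k ∧ DiscLimit P p ∧
      (∀ z ∈ Metric.ball (0 : ℂ) 1, K z * P z = 1) ∧
      ∀ᵐ t ∂turn, k t * p t = 1 ∧ ‖k t‖ ^ 2 = w t := by
  set s : ℝ → ℂ := fun t => (Real.sqrt (w t) : ℂ) with hs
  have hsm : AEStronglyMeasurable s turn := by
    exact (Complex.continuous_ofReal.comp Real.continuous_sqrt).comp_aestronglyMeasurable hw.1
  have hsL : MemLp s 2 turn := by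
    rw [memLp_two_iff_integrable_sq_norm hsm]
    refine hw.congr ?_
    filter_upwards [hwε] with t ht
    simp [hs, Real.sq_sqrt (hε.le.trans ht)]
  have hs_conj : ∀ t, (starRingEnd ℂ) (s t) = s t := fun t => Complex.conj_ofReal _
  have hs0 : ∀ᵐ t ∂turn, s t ≠ 0 := by
    filter_upwards [hwε] with t ht
    simpa [hs] using (Real.sqrt_pos.2 (hε.trans_le ht)).ne'
  have hsinv : ∀ᵐ t ∂turn, ‖(s t)⁻¹‖ ≤ (Real.sqrt ε)⁻¹ := by
    filter_upwards [hwε] with t ht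
    rw [norm_inv, hs, Complex.norm_real, Real.norm_of_nonneg (Real.sqrt_nonneg _)]
    exact inv_anti₀ (Real.sqrt_pos.2 hε) (Real.sqrt_le_sqrt ht)
  have hsinvL : MemLp (fun t => (s t)⁻¹) ∞ turn :=
    MemLp.of_bound hsm.aemeasurable.inv.aestronglyMeasurable _ hsinv
  have hsinv2 : MemLp (fun t => (s t)⁻¹) 2 turn :=
    MemLp.of_bound hsm.aemeasurable.inv.aestronglyMeasurable _ hsinv
  -- With `s = √w` and `V` the closed span of `s e^{imt}`, `m > 0`, the vector `x = s - P_V s` will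
  -- have constant modulus. Normalised by `d = |x|`, the outer function is `s x̄ / d` and its
  -- reciprocal is `x / (s d)`.
  let se : ℤ → Lp ℂ 2 turn := fun n => (memLp_mul_expi hsL n).toLp
  let V : Submodule ℂ (Lp ℂ 2 turn) :=
    (Submodule.span ℂ (se '' {n : ℤ | 0 < n})).topologicalClosure
  have : CompleteSpace V := (Submodule.isClosed_topologicalClosure _).completeSpace_coe
  have htest : ∀ y : Lp ℂ 2 turn, (∀ m : ℤ, 0 < m → inner ℂ (se m) y = 0) →
      ∀ v ∈ V, inner ℂ y v = 0 := by
    intro y hy v hv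
    have : y ∈ Vᗮ := by
      rw [Submodule.orthogonal_closure, Submodule.mem_orthogonal]
      intro u hu
      refine Submodule.span_induction (p := fun u _ => inner ℂ u y = 0) ?_ ?_ ?_ ?_ hu
      · rintro _ ⟨m, hm, rfl⟩; exact hy m hm
      · simp
      · intro a b _ _ ha hb; rw [inner_add_left, ha, hb, add_zero]
      · intro c a _ ha; rw [inner_smul_left, ha, mul_zero]
    exact (Submodule.mem_orthogonal' _ _).1 this v hv
  set x : Lp ℂ 2 turn := hsL.toLp - V.starProjection hsL.toLp with hx
  have hxm : MemLp x 2 turn := Lp.memLp x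
  have hxto : hxm.toLp x = x := Lp.toLp_coeFn x hxm
  have hxV : ∀ m : ℤ, 0 < m → ∫ t, x t * s t * expi (-m) t ∂turn = 0 := by
    intro m hm
    have h1 : inner ℂ (se m) x = 0 := (Submodule.mem_orthogonal _ _).1
      (Submodule.sub_starProjection_mem_orthogonal _) _
      (Submodule.le_topologicalClosure _ (Submodule.subset_span ⟨m, hm, rfl⟩))
    rw [← hxto, inner_toLp] at h1
    rw [← h1]
    congr 1; ext t
    rw [map_mul, hs_conj, conj_expi]; ring
  -- Against a vector orthogonal to `V`, `x` and `s` are indistinguishable. The next two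
  -- computations use this with `y = x e^{-int}` and `y = e^{-int}/s`.
  have hsub : ∀ y : Lp ℂ 2 turn, (∀ m : ℤ, 0 < m → inner ℂ (se m) y = 0) →
      inner ℂ y x = inner ℂ y hsL.toLp := by
    intro y hy
    rw [hx, inner_sub_right, htest y hy _ (Submodule.starProjection_apply_mem _ _), sub_zero]
  -- For `n > 0`, `x e^{-int}` is orthogonal to `V`, and its inner product with `s` is the conjugate
  -- of the relation `x ⊥ s e^{int}`.
  have hsq : ∀ n : ℤ, 0 < n → ∫ t, ((‖x t‖ ^ 2 : ℝ) : ℂ) * expi n t ∂turn = 0 := by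
    intro n hn
    have hy := memLp_mul_expi hxm (-n)
    have h1 := hsub hy.toLp fun m hm => by
      rw [inner_toLp, ← hxV (m + n) (by omega)]
      congr 1; ext t
      rw [map_mul, hs_conj, conj_expi, neg_add_rev, expi_add]; ring
    have h2 : inner ℂ hy.toLp hsL.toLp = (0 : ℂ) := by
      rw [inner_toLp]
      have h3 := congrArg (starRingEnd ℂ) (hxV n hn)
      rw [← integral_conj, map_zero] at h3
      rw [← h3]
      congr 1; ext t
      simp only [map_mul, hs_conj]; ring
    have h4 := inner_toLp hy hxm
    rw [hxto] at h4
    rw [h2, h4] at h1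
    rw [← h1]
    refine integral_congr_ae ?_
    filter_upwards with t
    rw [map_mul, conj_expi, neg_neg, ← mul_assoc, Complex.mul_conj']
    push_cast; ring
  obtain ⟨c, -, hcx⟩ := ae_eq_const_of_fourier
    ((memLp_two_iff_integrable_sq_norm hxm.1).1 hxm) hsq
  have hq : ∀ n : ℤ, 0 ≤ n → ∫ t, x t * (s t)⁻¹ * expi n t ∂turn = ∫ t, expi n t ∂turn := by
    intro n hn
    have hy := memLp_mul_expi hsinv2 (-n)
    have h1 := hsub hy.toLp fun m hm => by
      rw [inner_toLp]
      have e : ∫ t, (s t)⁻¹ * expi (-n) t * (starRingEnd ℂ) (s t * expi m t) ∂turn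
          = ∫ t, expi (-n - m) t ∂turn := by
        refine integral_congr_ae ?_
        filter_upwards [hs0] with t ht
        rw [map_mul, hs_conj, conj_expi, sub_eq_add_neg, expi_add]
        field_simp
      rw [e, integral_expi, if_neg (by omega)]
    have h2 : inner ℂ hy.toLp hsL.toLp = ∫ t, expi n t ∂turn := by
      rw [inner_toLp]
      refine integral_congr_ae ?_
      filter_upwards [hs0] with t ht
      rw [map_mul, map_inv₀, hs_conj, conj_expi, neg_neg]
      field_simp
    have h4 := inner_toLp hy hxm
    rw [hxto] at h4
    rw [h2, h4] at h1
    rw [← h1]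
    congr 1; ext t
    rw [map_mul, map_inv₀, hs_conj, conj_expi, neg_neg]; ring
  -- The constant is not zero because `x/s` has integral `2π`, by the case `n = 0` of `hq`.
  have hc0 : 0 < c := by
    have hne : c ≠ 0 := by
      rintro rfl
      have h1 := hq 0 le_rfl
      rw [integral_expi, if_pos rfl] at h1
      have h2 : ∫ t, x t * (s t)⁻¹ * expi 0 t ∂turn = ∫ t, (0 : ℂ) ∂turn := by
        refine integral_congr_ae ?_
        filter_upwards [hcx] with t ht
        have : x t = 0 := by simpa using ht
        rw [this, zero_mul, zero_mul]
      rw [h2, integral_zero] at h1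
      exact Real.two_pi_pos.ne (by exact_mod_cast h1)
    have hnn : 0 ≤ c := by
      have : (ae turn).NeBot := by
        rw [ae_neBot]; intro h
        have := turn_univ
        rw [h] at this
        simp only [Measure.coe_zero, Pi.zero_apply] at this
        exact (ENNReal.ofReal_pos.2 Real.two_pi_pos).ne this
      obtain ⟨t, ht⟩ := hcx.exists
      have ht' : ‖x t‖ ^ 2 = c := ht
      rw [← ht']; positivity
    exact lt_of_le_of_ne hnn hne.symm
  set d : ℂ := (Real.sqrt c : ℂ) with hd
  have hd2 : d * d = c := by rw [hd, ← Complex.ofReal_mul, Real.mul_self_sqrt hc0.le]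
  have hdn : ‖d‖ ^ 2 = c := by
    rw [hd, Complex.norm_real, Real.norm_eq_abs, sq_abs, Real.sq_sqrt hc0.le]
  have hd0 : d ≠ 0 := by
    rw [hd]; exact_mod_cast (Real.sqrt_pos.2 hc0).ne'
  set k : ℝ → ℂ := fun t => d⁻¹ * (s t * (starRingEnd ℂ) (x t)) with hk
  set p : ℝ → ℂ := fun t => d⁻¹ * (x t * (s t)⁻¹) with hp
  have hkp : ∀ᵐ t ∂turn, k t * p t = 1 ∧ ‖k t‖ ^ 2 = w t := by
    filter_upwards [hs0, hcx, hwε] with t h1 h2 h3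
    have h2' : ‖x t‖ ^ 2 = c := h2
    constructor
    · have h4 : (starRingEnd ℂ) (x t) * x t = c := by
        rw [Complex.conj_mul', ← h2']; push_cast; rfl
      calc k t * p t = (d * d)⁻¹ * ((starRingEnd ℂ) (x t) * x t) * (s t * (s t)⁻¹) := by
            simp only [hk, hp, mul_inv]; ring
        _ = 1 := by
            rw [h4, hd2, mul_inv_cancel₀ h1, mul_one, inv_mul_cancel₀]
            exact_mod_cast hc0.ne'
    · simp only [hk, norm_mul, norm_inv, mul_pow, inv_pow, hdn, RCLike.norm_conj, h2', hs,
        Complex.norm_real, Real.norm_eq_abs, sq_abs, Real.sq_sqrt (hε.le.trans h3)]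
      field_simp
  have hkm : AEStronglyMeasurable k turn :=
    (hsm.mul (memLp_conj hxm).1).const_mul _
  have hkL : MemLp k 2 turn := by
    rw [memLp_two_iff_integrable_sq_norm hkm]
    refine hw.congr ?_
    filter_upwards [hkp] with t ht using ht.2.symm
  have hpL : MemLp p 2 turn := (hsinvL.mul hxm).const_mul _
  have hK : DiscLimit (discExt k) k := discLimit_discExt hkL fun n hn => by
    have h3 := congrArg (starRingEnd ℂ) (hxV n hn)
    rw [← integral_conj, map_zero] at h3
    simp only [hk, mul_assoc]
    rw [integral_const_mul]
    refine mul_eq_zero_of_right _ ?_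
    rw [← h3]
    congr 1; ext t
    simp only [map_mul, hs_conj, conj_expi, neg_neg]; ring
  have hP : DiscLimit (discExt p) p := discLimit_discExt hpL fun n hn => by
    simp only [hp]
    have h3 := hq n hn.le
    rw [integral_expi, if_neg hn.ne'] at h3
    simp only [mul_assoc] at h3 ⊢
    rw [integral_const_mul, h3, mul_zero]
  exact ⟨_, _, k, p, hK, hP, fun z hz => hK.mul_eq_one hP (hkp.mono fun t h => h.1) hz, hkp⟩

/-- The logarithmic derivative of `K` is `K' P`, which has a primitive `H` on the disc; then `K
e^{-H}` is constant, and normalising at `0` makes it `1`. -/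
lemma exists_log_disc {K P : ℂ → ℂ} (hK : DifferentiableOn ℂ K (Metric.ball 0 1))
    (hP : DifferentiableOn ℂ P (Metric.ball 0 1))
    (hKP : ∀ z ∈ Metric.ball (0 : ℂ) 1, K z * P z = 1) :
    ∃ H : ℂ → ℂ, DifferentiableOn ℂ H (Metric.ball 0 1) ∧
      ∀ z ∈ Metric.ball (0 : ℂ) 1, Complex.exp (H z) = K z := by
  have h0 : (0 : ℂ) ∈ Metric.ball (0 : ℂ) 1 := Metric.mem_ball_self one_pos
  have hne : ∀ z ∈ Metric.ball (0 : ℂ) 1, K z ≠ 0 := fun z hz h => by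
    have := hKP z hz
    rw [h, zero_mul] at this
    exact zero_ne_one this
  have hd : DifferentiableOn ℂ (fun z => deriv K z * P z) (Metric.ball 0 1) :=
    (hK.deriv Metric.isOpen_ball).mul hP
  obtain ⟨H, hH0, hH⟩ := hd.isExactOn_ball.with_val_at 0 (Complex.log (K 0))
  have hKd : ∀ z ∈ Metric.ball (0 : ℂ) 1, HasDerivAt K (deriv K z) z := fun z hz =>
    (hK.differentiableAt (Metric.isOpen_ball.mem_nhds hz)).hasDerivAt
  have hconst : ∀ z ∈ Metric.ball (0 : ℂ) 1,
      HasDerivAt (fun z => K z * Complex.exp (-H z)) 0 z := fun z hz => by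
    have h1 := (hKd z hz).mul ((hH z hz).neg.cexp)
    convert! h1 using 1
    simp only [Pi.neg_apply]
    linear_combination (deriv K z * Complex.exp (-H z)) * (hKP z hz)
  refine ⟨H, fun z hz => (hH z hz).differentiableAt.differentiableWithinAt, fun z hz => ?_⟩
  have h2 := Metric.isOpen_ball.is_const_of_deriv_eq_zero
    (convex_ball (0 : ℂ) 1).isPreconnected
    (fun z hz => (hconst z hz).differentiableAt.differentiableWithinAt)
    (fun z hz => (hconst z hz).deriv) hz h0
  rw [hH0, Complex.exp_neg, Complex.exp_neg, Complex.exp_log (hne 0 h0),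
    mul_inv_cancel₀ (hne 0 h0)] at h2
  exact (eq_of_mul_inv_eq_one h2).symm

/-! ### Outer functions on the annulus. -/

/-- A vertical strip around the closed strip `log q ≤ Re w ≤ 0`, symmetric under the reflection
`w ↦ log q - conj w`. -/
def strip (q : ℝ) : Set ℂ := {w : ℂ | 3 / 2 * Real.log q < w.re ∧ w.re < -(1 / 2) * Real.log q}

lemma isOpen_strip (q : ℝ) : IsOpen (strip q) :=
  (isOpen_lt continuous_const Complex.continuous_re).inter
    (isOpen_lt Complex.continuous_re continuous_const)

/-- Given `H` holomorphic in the unit disc, the harmonic function on the annulus with boundary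
values `0` on `|z| = 1` and `-Re H` on `|z| = q` is the real part of a multivalued holomorphic
function, here written in the coordinate `w = log z`. -/
lemma exists_correction {q : ℝ} (hq : q ∈ Ioo (0 : ℝ) 1) {H : ℂ → ℂ}
    (hH : DifferentiableOn ℂ H (Metric.ball 0 1)) :
    ∃ C : ℂ → ℂ, ∃ β : ℝ, DifferentiableOn ℂ C (strip q) ∧
      (∀ w, C (w + 2 * Real.pi * Complex.I) = C w + 2 * Real.pi * Complex.I * β) ∧
      (∀ t : ℝ, (C (t * Complex.I)).re = 0) ∧
      ∀ t : ℝ, (C (Real.log q + t * Complex.I)).re = -(H (circlePt q t)).re := by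
  obtain ⟨hq0, hq1⟩ := hq
  set σ := Real.sqrt q with hσ
  have hσ0 : 0 < σ := Real.sqrt_pos.2 hq0
  have hσ1 : σ < 1 := by rw [hσ, Real.sqrt_lt' one_pos]; simpa using hq1
  have hσq : q = σ ^ 2 := (Real.sq_sqrt hq0.le).symm
  have hlog : Real.log q = 2 * Real.log σ := by rw [hσq, Real.log_pow]; norm_num
  have hlogneg : Real.log σ < 0 := Real.log_neg hσ0 hσ1
  obtain ⟨a, hsum⟩ : ∃ a : ℕ → ℂ, ∀ z ∈ Metric.ball (0 : ℂ) 1,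
      HasSum (fun n => a n * z ^ n) (H z) := by
    refine ⟨fun n => (n.factorial : ℂ)⁻¹ * iteratedDeriv n H 0, fun z hz => ?_⟩
    have := Complex.hasSum_taylorSeries_on_ball hH hz
    convert! this using 2 with n
    simp only [sub_zero, smul_eq_mul]; ring
  have hσsum : Summable fun n => ‖a n‖ * σ ^ n := by
    have := (hsum σ (by simpa [abs_of_pos hσ0] using hσ1)).summable.norm
    simpa [abs_of_pos hσ0] using this
  -- Chosen so that `b n (q^n - q^{-n}) = -q^n` for `n ≥ 1`, which gives the required value of `Re T
  -- n` on `Re w = log q`. For `n = 0` division by zero returns `0`, so the constant term drops out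
  -- and is handled by the linear term `β w`.
  set b : ℕ → ℝ := fun n => q ^ (2 * n) / (1 - q ^ (2 * n)) with hb
  have hb0 : b 0 = 0 := by simp [hb]
  have hqn : ∀ n : ℕ, n ≠ 0 → 0 < 1 - q ^ (2 * n) := fun n hn =>
    sub_pos.2 (pow_lt_one₀ hq0.le hq1 (by omega))
  have hbn : ∀ n, 0 ≤ b n := fun n => by
    rcases eq_or_ne n 0 with rfl | hn
    · rw [hb0]
    · exact div_nonneg (by positivity) (hqn n hn).le
  have hble : ∀ n, b n ≤ (1 - q ^ 2)⁻¹ * σ ^ (4 * n) := fun n => by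
    have h2 : 0 < 1 - q ^ 2 := hqn 1 one_ne_zero
    rcases eq_or_ne n 0 with rfl | hn
    · rw [hb0]; positivity
    · have h1 : q ^ (2 * n) ≤ q ^ 2 := pow_le_pow_of_le_one hq0.le hq1.le (by omega)
      have e : σ ^ (4 * n) = q ^ (2 * n) := by rw [hσq, ← pow_mul]; ring_nf
      rw [e, hb, mul_comm, ← div_eq_mul_inv]
      dsimp only
      gcongr
  -- On `Re w = 0` the bracket is a number minus its own conjugate, so its real part vanishes.
  set T : ℕ → ℂ → ℂ := fun n w =>
    (b n : ℂ) * (a n * Complex.exp (n * w) - (starRingEnd ℂ) (a n) * Complex.exp (-(n * w))) with hT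
  have hTd : ∀ n, Differentiable ℂ (T n) := fun n => by simp only [hT]; fun_prop
  have hexp : ∀ (n : ℕ) (u : ℝ), u ≤ -(3 * Real.log σ) → Real.exp (n * u) ≤ (σ ^ (3 * n))⁻¹ := by
    intro n u hu
    have : (σ ^ (3 * n))⁻¹ = Real.exp (n * -(3 * Real.log σ)) := by
      rw [← Real.exp_log (pow_pos hσ0 (3 * n)), ← Real.exp_neg, Real.log_pow]
      push_cast; ring_nf
    rw [this]
    gcongr
  -- With `σ = √q`, `b n` is of order `σ^{4n}`, while on the strip the exponentials are at most
  -- `σ^{-3n}`. The spare factor `σ^n` yields the series of `H` at `σ`, which converges absolutely.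
  have hTle : ∀ n, ∀ w ∈ strip q, ‖T n w‖ ≤ 2 * (1 - q ^ 2)⁻¹ * (‖a n‖ * σ ^ n) := by
    intro n w hw
    have hw1 := hw.1
    have hw2 := hw.2
    rw [hlog] at hw1 hw2
    have e1 : ‖Complex.exp (n * w)‖ ≤ (σ ^ (3 * n))⁻¹ := by
      rw [Complex.norm_exp]
      simpa using hexp n w.re (by linarith)
    have e2 : ‖Complex.exp (-(n * w))‖ ≤ (σ ^ (3 * n))⁻¹ := by
      rw [Complex.norm_exp]
      simpa using hexp n (-w.re) (by linarith)
    have h2 : 0 < 1 - q ^ 2 := hqn 1 one_ne_zero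
    have e3 : ‖a n * Complex.exp (n * w) - (starRingEnd ℂ) (a n) * Complex.exp (-(n * w))‖
        ≤ 2 * ‖a n‖ * (σ ^ (3 * n))⁻¹ := by
      refine (norm_sub_le _ _).trans ?_
      rw [norm_mul, norm_mul, RCLike.norm_conj]
      nlinarith [mul_le_mul_of_nonneg_left e1 (norm_nonneg (a n)),
        mul_le_mul_of_nonneg_left e2 (norm_nonneg (a n))]
    calc ‖T n w‖ = b n * ‖a n * Complex.exp (n * w)
            - (starRingEnd ℂ) (a n) * Complex.exp (-(n * w))‖ := by
          simp only [hT]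
          rw [norm_mul, Complex.norm_real, Real.norm_of_nonneg (hbn n)]
      _ ≤ ((1 - q ^ 2)⁻¹ * σ ^ (4 * n)) * (2 * ‖a n‖ * (σ ^ (3 * n))⁻¹) :=
          mul_le_mul (hble n) e3 (norm_nonneg _) (by positivity)
      _ = 2 * (1 - q ^ 2)⁻¹ * (‖a n‖ * σ ^ n) := by
          have : σ ^ (4 * n) = σ ^ n * σ ^ (3 * n) := by rw [← pow_add]; ring_nf
          have h3 : σ ^ (3 * n) ≠ 0 := by positivity
          rw [this]; field_simp
  have hsummT : ∀ w ∈ strip q, Summable fun n => T n w := fun w hw =>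
    Summable.of_norm_bounded (hσsum.mul_left _) fun n => hTle n w hw
  have hlogq : Real.log q < 0 := Real.log_neg hq0 hq1
  -- The real part of `β w` is `0` on `Re w = 0` and `-Re (a 0)` on `Re w = log q`; this term alone
  -- is not periodic.
  set β : ℝ := -(a 0).re / Real.log q with hβ
  refine ⟨fun w => β * w + ∑' n, T n w, β, ?_, ?_, ?_, ?_⟩
  · exact (differentiableOn_id.const_mul _).add
      (Complex.differentiableOn_tsum_of_summable_norm (hσsum.mul_left _)
        (fun n => (hTd n).differentiableOn) (isOpen_strip q) hTle)
  · intro w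
    have : ∀ n, T n (w + 2 * Real.pi * Complex.I) = T n w := fun n => by
      have e1 : Complex.exp (n * (w + 2 * Real.pi * Complex.I)) = Complex.exp (n * w) := by
        rw [mul_add, Complex.exp_add, Complex.exp_nat_mul_two_pi_mul_I, mul_one]
      simp only [hT, Complex.exp_neg, e1]
    simp only [this]; ring
  · intro t
    have hmem : (t * Complex.I : ℂ) ∈ strip q := by
      constructor <;> simp <;> linarith
    have : ∀ n, (T n (t * Complex.I)).re = 0 := fun n => by
      have e1 : Complex.exp (-(n * (t * Complex.I))) =
          (starRingEnd ℂ) (Complex.exp (n * (t * Complex.I))) := by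
        rw [← Complex.exp_conj]; simp
      simp only [hT, e1, ← map_mul, Complex.re_ofReal_mul, Complex.sub_re, Complex.conj_re,
        sub_self, mul_zero]
    rw [Complex.add_re, Complex.re_tsum (hsummT _ hmem)]
    simp [this]
  · intro t
    set w : ℂ := Real.log q + t * Complex.I with hw
    have hmem : w ∈ strip q := by
      constructor <;> simp [hw] <;> linarith
    have hz : circlePt q t ∈ Metric.ball (0 : ℂ) 1 := circlePt_mem_ball ⟨hq0.le, hq1⟩ t
    have hre : ∀ n, (T n w).re = -(a n * circlePt q t ^ n).re + if n = 0 then (a 0).re else 0 := by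
      intro n
      rcases eq_or_ne n 0 with rfl | hn
      · simp [hT, hb0]
      · have e1 : Complex.exp (n * w) = (q : ℂ) ^ n * expi n t := by
          rw [Complex.exp_nat_mul, hw, ← circlePt_eq_exp hq0, circlePt_pow]
        have e2 : (starRingEnd ℂ) (a n) * Complex.exp (-(n * w))
            = ((q ^ n)⁻¹ : ℝ) * (starRingEnd ℂ) (a n * expi n t) := by
          have h1 : expi (-(n : ℤ)) t = (expi n t)⁻¹ := by
            refine eq_inv_of_mul_eq_one_left ?_
            rw [← expi_add]; simp
          rw [Complex.exp_neg, e1, map_mul, conj_expi, h1, mul_inv]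
          push_cast; ring
        have e3 : a n * ((q : ℂ) ^ n * expi n t) = ((q ^ n : ℝ) : ℂ) * (a n * expi n t) := by
          push_cast; ring
        simp only [hT, e1, e2, circlePt_pow, e3, Complex.re_ofReal_mul, Complex.sub_re,
          Complex.conj_re]
        have h2 := (hqn n hn).ne'
        have h3 : q ^ n ≠ 0 := by positivity
        have e4 : q ^ (2 * n) = q ^ n * q ^ n := by rw [← pow_add]; ring_nf
        simp only [hb]
        rw [e4] at h2 ⊢
        rw [if_neg hn, add_zero, div_mul_eq_mul_div, div_eq_iff h2]
        field_simp
        ring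
    have hs1 := (Complex.hasSum_re (hsum _ hz)).neg.add (hasSum_ite_eq (0 : ℕ) (a 0).re)
    have hs2 : ∑' n, (T n w).re = -(H (circlePt q t)).re + (a 0).re := by
      simp_rw [hre]
      exact hs1.tsum_eq
    rw [Complex.add_re, Complex.re_tsum (hsummT _ hmem), hs2, Complex.re_ofReal_mul]
    have : w.re = Real.log q := by simp [hw]
    rw [this, hβ]
    have := hlogq.ne
    field_simp
    ring

lemma ae_turn_mem : ∀ᵐ t ∂turn, t ∈ Icc 0 (2 * Real.pi) := by
  filter_upwards [ae_restrict_mem (μ := volume) (measurableSet_Ico (a := 0) (b := 2 * Real.pi))]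
    with t ht using Ico_subset_Icc_self ht

/-- Multiplying a family converging in the quadratic mean by a family which is jointly continuous
at the limiting parameter. -/
lemma tendsto_eLpNorm_mul {l : Filter ℝ} {r₀ : ℝ} (hl : l ≤ 𝓝 r₀) {A B : ℝ → ℝ → ℂ} {a : ℝ → ℂ}
    (ha : MemLp a 2 turn) (hAm : ∀ᶠ r in l, MemLp (A r) 2 turn)
    (hBm : ∀ᶠ r in l, Continuous (B r)) (hB₀ : Continuous (B r₀))
    (hB : ∀ t, ContinuousAt (fun x : ℝ × ℝ => B x.1 x.2) (r₀, t))
    (hA : Tendsto (fun r => eLpNorm (fun t => A r t - a t) 2 turn) l (𝓝 0)) :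
    Tendsto (fun r => eLpNorm (fun t => A r t * B r t - a t * B r₀ t) 2 turn) l (𝓝 0) := by
  -- Joint continuity along the compact segment `{r₀} × [0, 2π]` gives uniform convergence in `t`.
  have hunif : ∀ ε : ℝ, 0 < ε → ∀ᶠ r in l, ∀ t ∈ Icc 0 (2 * Real.pi), ‖B r t - B r₀ t‖ ≤ ε := by
    intro ε hε
    refine (isCompact_Icc.eventually_forall_of_forall_eventually
      (x₀ := r₀) (P := fun r t => ‖B r t - B r₀ t‖ ≤ ε) fun t _ => ?_).filter_mono hl
    have h1 : ContinuousAt (fun x : ℝ × ℝ => ‖B x.1 x.2 - B r₀ x.2‖) (r₀, t) :=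
      ((hB t).sub (hB₀.continuousAt.comp continuousAt_snd)).norm
    have h2 := h1.eventually_lt (continuousAt_const (y := ε)) (by simpa using hε)
    exact h2.mono fun _ h => h.le
  obtain ⟨M, hM⟩ := isCompact_Icc.exists_bound_of_continuousOn
    (hB₀.continuousOn (s := Icc 0 (2 * Real.pi)))
  have lim1 : Tendsto (fun r => eLpNorm (fun t => (A r t - a t) * B r t) 2 turn) l (𝓝 0) := by
    refine tendsto_of_tendsto_of_tendsto_of_le_of_le' tendsto_const_nhds
      (by simpa using ENNReal.Tendsto.const_mul hA (Or.inr (ENNReal.ofReal_ne_top (r := M + 1))))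
      (Eventually.of_forall fun _ => zero_le) ?_
    filter_upwards [hunif 1 one_pos] with r hr
    refine eLpNorm_le_mul_eLpNorm_of_ae_le_mul ?_ 2
    filter_upwards [ae_turn_mem] with t ht
    rw [norm_mul, mul_comm]
    gcongr
    have : B r t = B r₀ t + (B r t - B r₀ t) := by ring
    rw [this]
    exact (norm_add_le _ _).trans (add_le_add (hM t ht) (hr t ht))
  have lim2 : Tendsto (fun r => eLpNorm (fun t => a t * (B r t - B r₀ t)) 2 turn) l (𝓝 0) := by
    rw [ENNReal.tendsto_nhds_zero]
    intro ε hε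
    obtain ⟨n, hn, hn'⟩ := ENNReal.exists_nnreal_pos_mul_lt ha.eLpNorm_ne_top hε.ne'
    filter_upwards [hunif n hn] with r hr
    refine le_trans ?_ hn'.le
    rw [← ENNReal.ofReal_coe_nnreal]
    refine eLpNorm_le_mul_eLpNorm_of_ae_le_mul ?_ 2
    filter_upwards [ae_turn_mem] with t ht
    rw [norm_mul, mul_comm]
    gcongr
    exact hr t ht
  refine tendsto_of_tendsto_of_tendsto_of_le_of_le' tendsto_const_nhds
    (by simpa using lim1.add lim2) (Eventually.of_forall fun _ => zero_le) ?_
  filter_upwards [hAm, hBm] with r h1 h2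
  have e : (fun t => A r t * B r t - a t * B r₀ t)
      = (fun t => (A r t - a t) * B r t) + fun t => a t * (B r t - B r₀ t) := by
    ext t; simp only [Pi.add_apply]; ring
  rw [e]
  exact eLpNorm_add_le ((h1.sub ha).1.mul h2.aestronglyMeasurable)
    (ha.1.mul (h2.sub hB₀).aestronglyMeasurable) (by norm_num)

lemma eLpNorm_mul_le_of_bound {f g : ℝ → ℂ} {M : ℝ}
    (hg : ∀ t ∈ Icc 0 (2 * Real.pi), ‖g t‖ ≤ M) :
    eLpNorm (fun t => f t * g t) 2 turn ≤ ENNReal.ofReal M * eLpNorm f 2 turn := by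
  refine eLpNorm_le_mul_eLpNorm_of_ae_le_mul ?_ 2
  filter_upwards [ae_turn_mem] with t ht
  rw [norm_mul, mul_comm]
  gcongr
  exact hg t ht

/-- A function of the Hardy class of index `α` with its boundary functions `f₁` on `B_1` and `f₂`
on `B_q`. -/
structure CoverLimit (q α : ℝ) (F : ℝ → ℝ → ℂ) (f₁ f₂ : ℝ → ℂ) : Prop where
  hardy : IsHardy q α F
  memLp_outer : MemLp f₁ 2 turn
  memLp_inner : MemLp f₂ 2 turn
  outer : Tendsto (fun r => eLpNorm (fun t => F r t - f₁ t) 2 turn) (𝓝[<] 1) (𝓝 0)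
  inner : Tendsto (fun r => eLpNorm (fun t => F r t - f₂ t) 2 turn) (𝓝[>] q) (𝓝 0)

/-- The product of a function holomorphic in `|z| < 1`, a function holomorphic in `|z| > q`, and
the exponential of an additively automorphic function on a neighborhood of the closed annulus. -/
def annulusProd (q : ℝ) (A D S : ℂ → ℂ) (r t : ℝ) : ℂ :=
  A (circlePt r t) * ((starRingEnd ℂ) (D (circlePt (q / r) t)) *
    Complex.exp (S (Real.log r + t * Complex.I)))

lemma continuous_circlePt_uncurry : Continuous fun x : ℝ × ℝ => circlePt x.1 x.2 := by
  unfold circlePt; fun_prop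

section

variable {q : ℝ} {A D S : ℂ → ℂ}

lemma continuousAt_disc (hA : DifferentiableOn ℂ A (Metric.ball 0 1)) {r : ℝ}
    (hr : r ∈ Ico (0 : ℝ) 1) (t : ℝ) :
    ContinuousAt (fun x : ℝ × ℝ => A (circlePt x.1 x.2)) (r, t) :=
  ContinuousAt.comp (f := fun x : ℝ × ℝ => circlePt x.1 x.2) (x := (r, t)) (g := A)
    (hA.continuousOn.continuousAt (Metric.isOpen_ball.mem_nhds (circlePt_mem_ball hr t)))
    continuous_circlePt_uncurry.continuousAt

lemma continuousAt_disc_inv (hq : 0 < q) (hD : DifferentiableOn ℂ D (Metric.ball 0 1)) {r : ℝ}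
    (hr : q < r) (t : ℝ) :
    ContinuousAt (fun x : ℝ × ℝ => (starRingEnd ℂ) (D (circlePt (q / x.1) x.2))) (r, t) := by
  have hr0 : 0 < r := hq.trans hr
  have h1 : ContinuousAt (fun x : ℝ × ℝ => (q / x.1, x.2)) (r, t) :=
    (continuousAt_const.div continuousAt_fst hr0.ne').prodMk continuousAt_snd
  have h2 := ContinuousAt.comp (f := fun x : ℝ × ℝ => (q / x.1, x.2)) (x := (r, t))
    (g := fun x : ℝ × ℝ => D (circlePt x.1 x.2))
    (continuousAt_disc hD ⟨by positivity, (div_lt_one hr0).2 hr⟩ t) h1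
  exact Complex.continuous_conj.continuousAt.comp h2

lemma continuousAt_exp_strip (hq : q ∈ Ioo (0 : ℝ) 1) (hS : DifferentiableOn ℂ S (strip q)) {r : ℝ}
    (hr : r ∈ Icc q 1) (t : ℝ) :
    ContinuousAt (fun x : ℝ × ℝ => Complex.exp (S (Real.log x.1 + x.2 * Complex.I))) (r, t) := by
  have hr0 : 0 < r := hq.1.trans_le hr.1
  have hlogq : Real.log q < 0 := Real.log_neg hq.1 hq.2
  have h1 : ContinuousAt (fun x : ℝ × ℝ => ((Real.log x.1 : ℂ) + x.2 * Complex.I)) (r, t) := by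
    refine ContinuousAt.add ?_ (by fun_prop)
    have h0 : ContinuousAt (fun x : ℝ × ℝ => Real.log x.1) (r, t) :=
      ContinuousAt.log continuousAt_fst hr0.ne'
    exact Complex.continuous_ofReal.continuousAt.comp h0
  have hmem : ((Real.log r : ℂ) + t * Complex.I) ∈ strip q := by
    have h2 := Real.log_le_log hq.1 hr.1
    have h3 := Real.log_nonpos hr0.le hr.2
    constructor <;> simp <;> linarith
  have h2 := ContinuousAt.comp (f := fun x : ℝ × ℝ => ((Real.log x.1 : ℂ) + x.2 * Complex.I))
    (x := (r, t)) (g := S)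
    (hS.continuousOn.continuousAt ((isOpen_strip q).mem_nhds hmem)) h1
  exact Complex.continuous_exp.continuousAt.comp h2

lemma continuous_of_continuousAt_uncurry {B : ℝ → ℝ → ℂ} {r : ℝ}
    (h : ∀ t, ContinuousAt (fun x : ℝ × ℝ => B x.1 x.2) (r, t)) : Continuous (B r) :=
  continuous_iff_continuousAt.2 fun t =>
    ContinuousAt.comp (f := fun t : ℝ => (r, t)) (x := t) (g := fun x : ℝ × ℝ => B x.1 x.2)
      (h t) (by fun_prop)

lemma exists_bound_uncurry {B : ℝ → ℝ → ℂ} {x y : ℝ}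
    (h : ∀ r ∈ Icc x y, ∀ t, ContinuousAt (fun x : ℝ × ℝ => B x.1 x.2) (r, t)) :
    ∃ M : ℝ, ∀ r ∈ Icc x y, ∀ t ∈ Icc 0 (2 * Real.pi), ‖B r t‖ ≤ M := by
  obtain ⟨M, hM⟩ := (isCompact_Icc.prod isCompact_Icc).exists_bound_of_continuousOn
    (s := Icc x y ×ˢ Icc 0 (2 * Real.pi)) (f := fun x : ℝ × ℝ => B x.1 x.2)
    fun p hp => (h p.1 hp.1 p.2).continuousWithinAt
  exact ⟨M, fun r hr t ht => hM (r, t) ⟨hr, ht⟩⟩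

lemma circlePt_add_two_pi (r t : ℝ) : circlePt r (t + 2 * Real.pi) = circlePt r t := by
  rw [circlePt, circlePt]
  push_cast
  rw [add_mul, Complex.exp_add, Complex.exp_two_pi_mul_I, mul_one]

/-- Near `|z| = 1` only the factor `A` is not continuous up to the boundary, and near `|z| = q` only
the factor built from `D`. At each circle one mean-square limit is therefore multiplied by a
continuous function, `B₁` or `B₂` below. Only `exp ∘ S` contributes to the index. -/
lemma coverLimit_annulusProd (hq : q ∈ Ioo (0 : ℝ) 1) {a d : ℝ → ℂ} (hA : DiscLimit A a)
    (hD : DiscLimit D d) (hS : DifferentiableOn ℂ S (strip q)) {α β : ℝ}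
    (hSβ : ∀ w, S (w + 2 * Real.pi * Complex.I) = S w + 2 * Real.pi * Complex.I * β)
    (hαβ : Complex.exp (2 * Real.pi * Complex.I * β) = Complex.exp (2 * Real.pi * Complex.I * α)) :
    CoverLimit q α (annulusProd q A D S)
      (fun t => a t * ((starRingEnd ℂ) (D (circlePt q t)) * Complex.exp (S (t * Complex.I))))
      (fun t => (starRingEnd ℂ) (d t) *
        (A (circlePt q t) * Complex.exp (S (Real.log q + t * Complex.I)))) := by
  obtain ⟨hq0, hq1⟩ := hq
  set B₁ : ℝ → ℝ → ℂ := fun r t => (starRingEnd ℂ) (D (circlePt (q / r) t)) *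
    Complex.exp (S (Real.log r + t * Complex.I)) with hB₁
  set B₂ : ℝ → ℝ → ℂ := fun r t => A (circlePt r t) *
    Complex.exp (S (Real.log r + t * Complex.I)) with hB₂
  have hc₁ : ∀ r ∈ Ioc q 1, ∀ t, ContinuousAt (fun x : ℝ × ℝ => B₁ x.1 x.2) (r, t) :=
    fun r hr t => (continuousAt_disc_inv hq0 hD.holo hr.1 t).mul
      (continuousAt_exp_strip ⟨hq0, hq1⟩ hS ⟨hr.1.le, hr.2⟩ t)
  have hc₂ : ∀ r ∈ Ico q 1, ∀ t, ContinuousAt (fun x : ℝ × ℝ => B₂ x.1 x.2) (r, t) :=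
    fun r hr t => (continuousAt_disc hA.holo ⟨hq0.le.trans hr.1, hr.2⟩ t).mul
      (continuousAt_exp_strip ⟨hq0, hq1⟩ hS ⟨hr.1, hr.2.le⟩ t)
  have e₁ : ∀ r t, annulusProd q A D S r t = A (circlePt r t) * B₁ r t := fun r t => rfl
  have e₂ : ∀ r t, annulusProd q A D S r t
      = (starRingEnd ℂ) (D (circlePt (q / r) t)) * B₂ r t := fun r t => by
    rw [e₁]; simp only [hB₁, hB₂]; ring
  have hb₁ : ∀ t, B₁ 1 t = (starRingEnd ℂ) (D (circlePt q t)) * Complex.exp (S (t * Complex.I)) :=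
    fun t => by simp [hB₁]
  have hb₁c : Continuous (B₁ 1) := continuous_of_continuousAt_uncurry (hc₁ 1 ⟨hq1, le_rfl⟩)
  have hb₂c : Continuous (B₂ q) := continuous_of_continuousAt_uncurry (hc₂ q ⟨le_rfl, hq1⟩)
  have hdiv : ∀ r ∈ Ioo q 1, q / r ∈ Ico (0 : ℝ) 1 := fun r hr =>
    ⟨div_nonneg hq0.le (hq0.trans hr.1).le, (div_lt_one (hq0.trans hr.1)).2 hr.1⟩
  have hmem : ∀ {f g : ℝ → ℂ}, MemLp f 2 turn → Continuous g →
      MemLp (fun t => f t * g t) 2 turn := fun {f g} hf hg => by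
    obtain ⟨M, hM⟩ := isCompact_Icc.exists_bound_of_continuousOn
      (hg.continuousOn (s := Icc 0 (2 * Real.pi)))
    exact ⟨hf.1.mul hg.aestronglyMeasurable, (eLpNorm_mul_le_of_bound hM).trans_lt
      (ENNReal.mul_lt_top ENNReal.ofReal_lt_top hf.2)⟩
  refine ⟨⟨?_, ?_, ?_⟩, ?_, ?_, ?_, ?_⟩
  · have h1 : DifferentiableOn ℂ (fun w => A (Complex.exp w)) {w : ℂ | Real.log q < w.re ∧ w.re < 0} :=
      hA.holo.comp Complex.differentiable_exp.differentiableOn fun w hw => by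
        rw [mem_ball_zero_iff, Complex.norm_exp]; exact Real.exp_lt_one_iff.2 hw.2
    -- For `z = r e^{it}`, the point `circlePt (q / r) t` is `q / z̄`; conjugating both outside and
    -- inside makes the factor holomorphic in `z`.
    have hD' : DifferentiableOn ℂ (fun z => (starRingEnd ℂ) (D ((starRingEnd ℂ) z)))
        (Metric.ball 0 1) := fun z hz => by
      have : DifferentiableAt ℂ D ((starRingEnd ℂ) z) :=
        hD.holo.differentiableAt (Metric.isOpen_ball.mem_nhds (by simpa using hz))
      exact (differentiableAt_conj_conj_iff.2 this).differentiableWithinAt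
    have h2 : DifferentiableOn ℂ (fun w => (starRingEnd ℂ) (D ((starRingEnd ℂ)
        (Complex.exp (Real.log q - w))))) {w : ℂ | Real.log q < w.re ∧ w.re < 0} :=
      hD'.comp (f := fun w => Complex.exp (Real.log q - w)) (by fun_prop) fun w hw => by
        rw [mem_ball_zero_iff, Complex.norm_exp]
        refine Real.exp_lt_one_iff.2 ?_
        have := hw.1
        simp; linarith
    have h3 : DifferentiableOn ℂ (fun w => Complex.exp (S w))
        {w : ℂ | Real.log q < w.re ∧ w.re < 0} :=
      (hS.mono fun w hw => by
        have h1 := hw.1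
        have h2 := hw.2
        constructor <;> linarith).cexp
    refine (h1.mul (h2.mul h3)).congr fun w hw => ?_
    have e1 : circlePt (Real.exp w.re) w.im = Complex.exp w := by
      rw [circlePt_eq_exp (Real.exp_pos _), Real.log_exp, Complex.re_add_im]
    have e2 : circlePt (q / Real.exp w.re) w.im
        = (starRingEnd ℂ) (Complex.exp (Real.log q - w)) := by
      rw [circlePt_eq_exp (by positivity), Real.log_div hq0.ne' (Real.exp_pos _).ne', Real.log_exp,
        ← Complex.exp_conj]
      congr 1
      apply Complex.ext <;> simp
    simp only [annulusProd, e1, e2, Real.log_exp, Complex.re_add_im, Pi.mul_apply]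
  · intro r hr t
    have e : (Real.log r : ℂ) + ((t + 2 * Real.pi : ℝ) : ℂ) * Complex.I
        = (Real.log r + t * Complex.I) + 2 * Real.pi * Complex.I := by push_cast; ring
    simp only [annulusProd, circlePt_add_two_pi, e, hSβ, Complex.exp_add, hαβ]
    ring
  -- The annulus is cut at the intermediate radius `√q`: `B₁` is bounded on the outer closed part,
  -- `B₂` on the inner one.
  · set σ := Real.sqrt q with hσ
    have hσ1 : σ < 1 := by rw [hσ, Real.sqrt_lt' one_pos]; simpa using hq1
    have hσ0 : 0 < σ := Real.sqrt_pos.2 hq0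
    have hσq : q < σ := by nlinarith [Real.mul_self_sqrt hq0.le]
    obtain ⟨M₁, hM₁⟩ := exists_bound_uncurry (x := σ) (y := 1)
      fun r hr => hc₁ r ⟨hσq.trans_le hr.1, hr.2⟩
    obtain ⟨M₂, hM₂⟩ := exists_bound_uncurry (x := q) (y := σ)
      fun r hr => hc₂ r ⟨hr.1, hr.2.trans_lt hσ1⟩
    refine ⟨(ENNReal.ofReal M₁ * eLpNorm a 2 turn + ENNReal.ofReal M₂ * eLpNorm d 2 turn).toNNReal,
      fun r hr => ?_⟩
    rw [ENNReal.coe_toNNReal (ENNReal.add_ne_top.2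
      ⟨ENNReal.mul_ne_top ENNReal.ofReal_ne_top hA.memLp.eLpNorm_ne_top,
        ENNReal.mul_ne_top ENNReal.ofReal_ne_top hD.memLp.eLpNorm_ne_top⟩)]
    rcases le_total σ r with h | h
    · refine le_trans ?_ le_self_add
      refine (eLpNorm_mul_le_of_bound (g := B₁ r) (hM₁ r ⟨h, hr.2.le⟩)).trans ?_
      gcongr
      exact hA.bdd r ⟨(hq0.trans hr.1).le, hr.2⟩
    · refine le_trans ?_ le_add_self
      have : annulusProd q A D S r
          = fun t => (starRingEnd ℂ) (D (circlePt (q / r) t)) * B₂ r t := funext (e₂ r)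
      rw [this]
      refine (eLpNorm_mul_le_of_bound (g := B₂ r) (hM₂ r ⟨hr.1.le, h⟩)).trans ?_
      gcongr
      rw [eLpNorm_congr_norm_ae (g := fun t => D (circlePt (q / r) t)) (by simp)]
      exact hD.bdd _ (hdiv r hr)
  · simpa only [hb₁] using hmem hA.memLp hb₁c
  · exact hmem (memLp_conj hD.memLp) hb₂c
  · have hev : ∀ᶠ r in 𝓝[<] (1 : ℝ), r ∈ Ioo q 1 := Ioo_mem_nhdsLT hq1
    have := tendsto_eLpNorm_mul (l := 𝓝[<] 1) nhdsWithin_le_nhds (B := B₁) hA.memLp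
      (hev.mono fun r hr => hA.memLp_circle ⟨(hq0.trans hr.1).le, hr.2⟩ 2)
      (hev.mono fun r hr => continuous_of_continuousAt_uncurry (hc₁ r ⟨hr.1, hr.2.le⟩))
      hb₁c (hc₁ 1 ⟨hq1, le_rfl⟩) hA.lim
    simpa only [e₁, hb₁] using this
  · have hev : ∀ᶠ r in 𝓝[>] q, r ∈ Ioo q 1 := Ioo_mem_nhdsGT hq1
    have hdl : Tendsto (fun r => q / r) (𝓝[>] q) (𝓝[<] 1) := by
      refine tendsto_nhdsWithin_iff.2 ⟨?_, hev.mono fun r hr => (hdiv r hr).2⟩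
      have : ContinuousAt (fun r => q / r) q := continuousAt_const.div continuousAt_id hq0.ne'
      have h := this.tendsto.mono_left (nhdsWithin_le_nhds (s := Ioi q))
      rwa [div_self hq0.ne'] at h
    have hlim : Tendsto (fun r => eLpNorm (fun t => (starRingEnd ℂ) (D (circlePt (q / r) t))
        - (starRingEnd ℂ) (d t)) 2 turn) (𝓝[>] q) (𝓝 0) := by
      refine (hD.lim.comp hdl).congr fun r => ?_
      refine eLpNorm_congr_norm_ae (Eventually.of_forall fun t => ?_)
      rw [← map_sub, RCLike.norm_conj]
    have := tendsto_eLpNorm_mul (l := 𝓝[>] q) nhdsWithin_le_nhds (B := B₂) (memLp_conj hD.memLp)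
      (hev.mono fun r hr => memLp_conj (hD.memLp_circle (hdiv r hr) 2))
      (hev.mono fun r hr => continuous_of_continuousAt_uncurry (hc₂ r ⟨hr.1.le, hr.2⟩))
      hb₂c (hc₂ q ⟨le_rfl, hq1⟩) hlim
    simpa only [e₂] using this

end

/-- Outer functions on the annulus: integrable weights on the two boundary circles, bounded below,
are the squared moduli of the boundary functions of a function of some Hardy class `H²_α` without
zeros, whose reciprocal has square integrable boundary functions too. -/
lemma exists_outer_annulus {q : ℝ} (hq : q ∈ Ioo (0 : ℝ) 1) {w₁ w₂ : ℝ → ℝ}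
    (hw₁ : Integrable w₁ turn) (hw₂ : Integrable w₂ turn) {ε : ℝ} (hε : 0 < ε)
    (hε₁ : ∀ᵐ t ∂turn, ε ≤ w₁ t) (hε₂ : ∀ᵐ t ∂turn, ε ≤ w₂ t) :
    ∃ α ∈ Ico (0 : ℝ) 1, ∃ F F' : ℝ → ℝ → ℂ, ∃ f₁ f₂ f₁' f₂' : ℝ → ℂ,
      CoverLimit q α F f₁ f₂ ∧ CoverLimit q (-α) F' f₁' f₂' ∧
      (∀ᵐ t ∂turn, f₁ t * f₁' t = 1 ∧ ‖f₁ t‖ ^ 2 = w₁ t) ∧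
      (∀ᵐ t ∂turn, f₂ t * f₂' t = 1 ∧ ‖f₂ t‖ ^ 2 = w₂ t) := by
  obtain ⟨hq0, hq1⟩ := hq
  obtain ⟨K₁, P₁, k₁, p₁, hK₁, hP₁, hKP₁, hkp₁⟩ := exists_outer_disc hw₁ hε hε₁
  obtain ⟨K₂, P₂, k₂, p₂, hK₂, hP₂, hKP₂, hkp₂⟩ := exists_outer_disc hw₂ hε hε₂
  obtain ⟨H₁, hH₁, hHK₁⟩ := exists_log_disc hK₁.holo hP₁.holo hKP₁
  obtain ⟨H₂, hH₂, hHK₂⟩ := exists_log_disc hK₂.holo hP₂.holo hKP₂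
  obtain ⟨C₁, β₁, hC₁, hC₁per, hC₁0, hC₁q⟩ := exists_correction ⟨hq0, hq1⟩ hH₁
  obtain ⟨C₂, β₂, hC₂, hC₂per, hC₂0, hC₂q⟩ := exists_correction ⟨hq0, hq1⟩ hH₂
  -- Reflection exchanges the two boundary lines, so `R` corrects on `|z| = 1` the modulus of the
  -- factor attached to `|z| = q`. The reflection also reverses the sign of the period, whence `β =
  -- β₁ - β₂`.
  set R : ℂ → ℂ := fun w => (starRingEnd ℂ) (C₂ ((starRingEnd ℂ) (Real.log q - w))) with hR
  have hRd : DifferentiableOn ℂ R (strip q) := fun w hw => by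
    have h1 : DifferentiableAt ℂ C₂ ((starRingEnd ℂ) (Real.log q - w)) := by
      refine hC₂.differentiableAt ((isOpen_strip q).mem_nhds ?_)
      have h1 := hw.1
      have h2 := hw.2
      constructor <;> simp <;> linarith
    have h2 : DifferentiableAt ℂ (fun z => (starRingEnd ℂ) (C₂ ((starRingEnd ℂ) z)))
        (Real.log q - w) := differentiableAt_conj_conj_iff.2 h1
    exact (DifferentiableAt.comp (f := fun w => (Real.log q : ℂ) - w) w h2
      (by fun_prop)).differentiableWithinAt
  set S : ℂ → ℂ := fun w => C₁ w + R w with hS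
  have hSd : DifferentiableOn ℂ S (strip q) := hC₁.add hRd
  set β := β₁ - β₂ with hβ
  have hRper : ∀ w, R (w + 2 * Real.pi * Complex.I) = R w - 2 * Real.pi * Complex.I * β₂ := by
    intro w
    have e : (starRingEnd ℂ) (Real.log q - (w + 2 * Real.pi * Complex.I))
        = (starRingEnd ℂ) (Real.log q - w) + 2 * Real.pi * Complex.I := by
      apply Complex.ext <;> simp
      ring
    simp only [hR, e, hC₂per, map_add, map_mul, Complex.conj_I, Complex.conj_ofReal, map_ofNat]
    ring
  have hSper : ∀ w, S (w + 2 * Real.pi * Complex.I) = S w + 2 * Real.pi * Complex.I * β := by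
    intro w
    simp only [hS, hC₁per, hRper, hβ]; push_cast; ring
  -- Only `β` modulo `1` matters for the index, so its fractional part serves as `α`.
  have hfr : Complex.exp (2 * Real.pi * Complex.I * β)
      = Complex.exp (2 * Real.pi * Complex.I * (Int.fract β : ℝ)) := by
    rw [Complex.exp_eq_exp_iff_exists_int]
    refine ⟨⌊β⌋, ?_⟩
    have : (β : ℂ) = ⌊β⌋ + (Int.fract β : ℝ) := by
      exact_mod_cast (Int.floor_add_fract β).symm
    conv_lhs => rw [this]
    ring
  have hre₁ : ∀ t : ℝ, (S (t * Complex.I)).re = -(H₂ (circlePt q t)).re := by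
    intro t
    have e : (starRingEnd ℂ) (Real.log q - t * Complex.I : ℂ) = Real.log q + t * Complex.I := by
      apply Complex.ext <;> simp
    simp only [hS, hR, Complex.add_re, hC₁0, e, Complex.conj_re, hC₂q, zero_add]
  have hre₂ : ∀ t : ℝ, (S (Real.log q + t * Complex.I)).re = -(H₁ (circlePt q t)).re := by
    intro t
    have e : (starRingEnd ℂ) (Real.log q - (Real.log q + t * Complex.I) : ℂ) = t * Complex.I := by
      apply Complex.ext <;> simp
    simp only [hS, hR, Complex.add_re, hC₁q, e, Complex.conj_re, hC₂0, add_zero]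
  have hcirc : ∀ t, circlePt q t ∈ Metric.ball (0 : ℂ) 1 := circlePt_mem_ball ⟨hq0.le, hq1⟩
  refine ⟨Int.fract β, ⟨Int.fract_nonneg _, Int.fract_lt_one _⟩, _, _, _, _, _, _,
    coverLimit_annulusProd ⟨hq0, hq1⟩ hK₁ hK₂ hSd hSper hfr,
    coverLimit_annulusProd ⟨hq0, hq1⟩ hP₁ hP₂ hSd.neg (β := -β) ?_ ?_, ?_, ?_⟩
  · intro w
    simp only [Pi.neg_apply, hSper]; push_cast; ring
  · push_cast
    rw [mul_neg, mul_neg, Complex.exp_neg, Complex.exp_neg, hfr]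
  · filter_upwards [hkp₁] with t ht
    constructor
    · have h2 := congrArg (starRingEnd ℂ) (hKP₂ _ (hcirc t))
      rw [map_mul, map_one] at h2
      rw [Pi.neg_apply, Complex.exp_neg]
      have h3 := Complex.exp_ne_zero (S (t * Complex.I))
      calc _ = (k₁ t * p₁ t) * ((starRingEnd ℂ) (K₂ (circlePt q t)) *
              (starRingEnd ℂ) (P₂ (circlePt q t))) *
              (Complex.exp (S (t * Complex.I)) * (Complex.exp (S (t * Complex.I)))⁻¹) := by ring
        _ = 1 := by rw [ht.1, h2, mul_inv_cancel₀ h3]; norm_num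
    · rw [norm_mul, norm_mul, RCLike.norm_conj, Complex.norm_exp, hre₁, ← hHK₂ _ (hcirc t),
        Complex.norm_exp, ← Real.exp_add, add_neg_cancel, Real.exp_zero, mul_one, ht.2]
  · filter_upwards [hkp₂] with t ht
    constructor
    · have h1 := congrArg (starRingEnd ℂ) ht.1
      rw [map_mul, map_one] at h1
      rw [Pi.neg_apply, Complex.exp_neg]
      have h3 := Complex.exp_ne_zero (S (Real.log q + t * Complex.I))
      calc _ = ((starRingEnd ℂ) (k₂ t) * (starRingEnd ℂ) (p₂ t)) * (K₁ (circlePt q t) *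
              P₁ (circlePt q t)) * (Complex.exp (S (Real.log q + t * Complex.I)) *
              (Complex.exp (S (Real.log q + t * Complex.I)))⁻¹) := by ring
        _ = 1 := by rw [h1, hKP₁ _ (hcirc t), mul_inv_cancel₀ h3]; norm_num
    · rw [norm_mul, norm_mul, RCLike.norm_conj, Complex.norm_exp, hre₂, ← hHK₁ _ (hcirc t),
        Complex.norm_exp, ← Real.exp_add, add_neg_cancel, Real.exp_zero, mul_one, ht.2]

/-! ### Duality between the indices `α` and `-α`. -/

/-- The Hardy classes of indices `α` and `-α` pair to the same value on both circles. -/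
lemma integral_mul_eq_of_coverLimit {q α : ℝ} (hq : q ∈ Ioo (0 : ℝ) 1) {F F' : ℝ → ℝ → ℂ}
    {f₁ f₂ f₁' f₂' : ℝ → ℂ} (h : CoverLimit q α F f₁ f₂) (h' : CoverLimit q (-α) F' f₁' f₂') :
    ∫ t, f₁ t * f₁' t ∂turn = ∫ t, f₂ t * f₂' t ∂turn := by
  obtain ⟨hq0, hq1⟩ := hq
  have hm : ∀ r ∈ Ioo q 1, MemLp (F r) 2 turn := fun r hr =>
    memLp_of_continuous (h.hardy.holo.continuous hq0 hr) 2
  have hm' : ∀ r ∈ Ioo q 1, MemLp (F' r) 2 turn := fun r hr =>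
    memLp_of_continuous (h'.hardy.holo.continuous hq0 hr) 2
  have ev1 : ∀ᶠ r in 𝓝[<] (1 : ℝ), r ∈ Ioo q 1 := Ioo_mem_nhdsLT hq1
  have evq : ∀ᶠ r in 𝓝[>] q, r ∈ Ioo q 1 := Ioo_mem_nhdsGT hq1
  have l1 := tendsto_integral_mul (ev1.mono hm) (ev1.mono hm') h.memLp_outer h'.memLp_outer
    h.outer h'.outer
  have lq := tendsto_integral_mul (evq.mono hm) (evq.mono hm') h.memLp_inner h'.memLp_inner
    h.inner h'.inner
  have hG := h.hardy.holo.mul h'.hardy.holo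
  have hval : ∀ r ∈ Ioo q 1, ∀ t : ℝ, ((fun w : ℂ => F (Real.exp w.re) w.im) *
      fun w : ℂ => F' (Real.exp w.re) w.im) (Real.log r + t * Complex.I) = F r t * F' r t := by
    intro r hr t
    have h1 : ((Real.log r : ℂ) + t * Complex.I).re = Real.log r := by simp
    have h2 : ((Real.log r : ℂ) + t * Complex.I).im = t := by simp
    simp only [Pi.mul_apply, h1, h2, Real.exp_log (hq0.trans hr.1)]
  have hconst : ∀ r ∈ Ioo q 1, ∀ ρ ∈ Ioo q 1,
      ∫ t, F r t * F' r t ∂turn = ∫ t, F ρ t * F' ρ t ∂turn := by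
    intro r hr ρ hρ
    have hmem : ∀ r ∈ Ioo q 1, Real.log r ∈ Ioo (Real.log q) 0 := fun r hr =>
      ⟨Real.log_lt_log hq0 hr.1, Real.log_neg (hq0.trans hr.1) hr.2⟩
    have := integral_vertical_eq hG (fun x hx => ?_) (hmem r hr) (hmem ρ hρ)
    · simpa only [hval r hr, hval ρ hρ] using this
    · have hx' : Real.exp x ∈ Ioo q 1 :=
        ⟨(Real.log_lt_iff_lt_exp hq0).1 hx.1, Real.exp_lt_one_iff.2 hx.2⟩
      have e1 := hval _ hx' (0 + 2 * Real.pi)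
      have e2 := hval _ hx' 0
      rw [h.hardy.index _ hx', h'.hardy.index _ hx', Real.log_exp] at e1
      rw [Real.log_exp] at e2
      simp only [zero_add, Complex.ofReal_zero, zero_mul, add_zero] at e1 e2
      rw [e1, e2]
      -- The two multipliers are inverse to each other, so the product is single-valued and Cauchy's
      -- theorem applies.
      have : Complex.exp (2 * Real.pi * Complex.I * α)
          * Complex.exp (2 * Real.pi * Complex.I * (-α : ℝ)) = 1 := by
        rw [← Complex.exp_add]; push_cast
        rw [mul_neg, add_neg_cancel, Complex.exp_zero]
      linear_combination (F (Real.exp x) 0 * F' (Real.exp x) 0) * this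
  obtain ⟨ρ, hρ⟩ := exists_between hq1
  have c1 := tendsto_nhds_unique l1 (tendsto_const_nhds.congr'
    (ev1.mono fun r hr => hconst ρ hρ r hr))
  have cq := tendsto_nhds_unique lq (tendsto_const_nhds.congr'
    (evq.mono fun r hr => hconst ρ hρ r hr))
  rw [c1, cq]

lemma discLimit_one : DiscLimit (fun _ => 1) (fun _ => 1) where
  holo := differentiableOn_const _
  memLp := memLp_const _
  bdd := fun _ _ => le_rfl
  lim := by simp

/-- The exponentials `z^{β}` on the cover. -/
lemma coverLimit_exp {q : ℝ} (hq : q ∈ Ioo (0 : ℝ) 1) {α β : ℝ}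
    (h : Complex.exp (2 * Real.pi * Complex.I * β) = Complex.exp (2 * Real.pi * Complex.I * α)) :
    ∃ F, CoverLimit q α F (fun t => Complex.exp (β * (t * Complex.I)))
      (fun t => Complex.exp (β * (Real.log q + t * Complex.I))) := by
  refine ⟨annulusProd q (fun _ => 1) (fun _ => 1) fun w => β * w, ?_⟩
  have := coverLimit_annulusProd hq discLimit_one discLimit_one
    (S := fun w => β * w) (by fun_prop) (fun w => by ring) h
  simpa only [map_one, one_mul] using this

/-- The Fourier coefficients of the boundary functions of a function in the Hardy class of
index `α`. -/
lemma CoverLimit.fourier {q α : ℝ} (hq : q ∈ Ioo (0 : ℝ) 1) {F : ℝ → ℝ → ℂ} {f₁ f₂ : ℝ → ℂ}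
    (h : CoverLimit q α F f₁ f₂) (n : ℤ) :
    ∫ t, f₁ t * Complex.exp (-(n + α) * (t * Complex.I)) ∂turn
      = Complex.exp (-(n + α) * Real.log q) *
        ∫ t, f₂ t * Complex.exp (-(n + α) * (t * Complex.I)) ∂turn := by
  -- The partner of `F` in the pairing is `z^{-(n+α)}`, of index `-α`.
  have hper : Complex.exp (2 * Real.pi * Complex.I * (-(n + α) : ℝ))
      = Complex.exp (2 * Real.pi * Complex.I * (-α : ℝ)) := by
    rw [Complex.exp_eq_exp_iff_exists_int]
    exact ⟨-n, by push_cast; ring⟩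
  obtain ⟨F', hF'⟩ := coverLimit_exp hq hper
  have := integral_mul_eq_of_coverLimit hq h hF'
  push_cast at this
  rw [this, ← integral_const_mul]
  congr 1; ext t
  rw [mul_add, Complex.exp_add]; ring

/-! ### Passing between `L²(B)` and pairs of functions on one turn. -/

section boundary

variable {q : ℝ}

lemma integrable_bdry_iff {E : Type*} [NormedAddCommGroup E] {f : ℂ → E}
    (hf : AEStronglyMeasurable f (bdryMeasure q)) :
    Integrable f (bdryMeasure q) ↔ Integrable (fun t => f (circlePt 1 t)) turn ∧
      Integrable (fun t => f (circlePt q t)) turn := by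
  rw [bdryMeasure] at hf ⊢
  rw [integrable_add_measure, circleMeasure, circleMeasure,
    integrable_map_measure (hf.mono_measure (Measure.le_add_right le_rfl))
      (continuous_circlePt 1).measurable.aemeasurable,
    integrable_map_measure (hf.mono_measure (Measure.le_add_left le_rfl))
      (continuous_circlePt q).measurable.aemeasurable]
  rfl

lemma integral_bdry {f : ℂ → ℂ} (hf : Integrable f (bdryMeasure q)) :
    ∫ z, f z ∂bdryMeasure q
      = ∫ t, f (circlePt 1 t) ∂turn + ∫ t, f (circlePt q t) ∂turn := by
  have h := hf
  rw [bdryMeasure, integrable_add_measure] at h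
  rw [bdryMeasure, integral_add_measure h.1 h.2, circleMeasure, circleMeasure,
    integral_map (continuous_circlePt 1).measurable.aemeasurable h.1.1,
    integral_map (continuous_circlePt q).measurable.aemeasurable h.2.1]

lemma ae_bdry_of {p : ℂ → Prop} (hp : MeasurableSet {z | p z})
    (h1 : ∀ᵐ t ∂turn, p (circlePt 1 t)) (h2 : ∀ᵐ t ∂turn, p (circlePt q t)) :
    ∀ᵐ z ∂bdryMeasure q, p z := by
  rw [bdryMeasure, ae_add_measure_iff, circleMeasure, circleMeasure,
    ae_map_iff (continuous_circlePt 1).measurable.aemeasurable hp,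
    ae_map_iff (continuous_circlePt q).measurable.aemeasurable hp]
  exact ⟨h1, h2⟩

lemma memLp_comp (g : L2B q) : MemLp (fun t => g (circlePt 1 t)) 2 turn ∧
    MemLp (fun t => g (circlePt q t)) 2 turn := by
  have h := (memLp_two_iff_integrable_sq_norm (Lp.aestronglyMeasurable g)).1 (Lp.memLp g)
  rw [integrable_bdry_iff (f := fun z => ‖g z‖ ^ 2) ((Lp.aestronglyMeasurable g).norm.pow 2)] at h
  exact ⟨(memLp_two_iff_integrable_sq_norm (aesm_comp g).1).2 h.1,
    (memLp_two_iff_integrable_sq_norm (aesm_comp g).2).2 h.2⟩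

/-- The parameter in `[0, 2π)` of a point on a circle. -/
def angle (z : ℂ) : ℝ := if z.arg < 0 then z.arg + 2 * Real.pi else z.arg

lemma measurable_angle : Measurable angle :=
  Measurable.ite (measurableSet_lt Complex.measurable_arg measurable_const)
    (Complex.measurable_arg.add_const _) Complex.measurable_arg

lemma angle_circlePt {r t : ℝ} (hr : 0 < r) (ht : t ∈ Ico 0 (2 * Real.pi)) :
    angle (circlePt r t) = t := by
  have h : (circlePt r t).arg = toIocMod Real.two_pi_pos (-Real.pi) t := by
    rw [circlePt, Complex.exp_mul_I]
    exact Complex.arg_mul_cos_add_sin_mul_I_eq_toIocMod hr t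
  rw [angle, h]
  rcases le_or_gt t Real.pi with h1 | h1
  · have : toIocMod Real.two_pi_pos (-Real.pi) t = t :=
      (toIocMod_eq_self Real.two_pi_pos).2 ⟨by linarith [Real.pi_pos, ht.1], by linarith⟩
    rw [this, if_neg (not_lt.2 ht.1)]
  · have : toIocMod Real.two_pi_pos (-Real.pi) t = t - 2 * Real.pi := by
      rw [← toIocMod_sub Real.two_pi_pos, (toIocMod_eq_self Real.two_pi_pos).2]
      exact ⟨by linarith, by linarith [ht.2, Real.pi_pos]⟩
    rw [this, if_pos (by linarith [ht.2])]; ring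

/-- The modulus tells the two circles apart and `angle` inverts the parametrisation measurably, so
arbitrary data on the two circles define an element of `L²(B)`. -/
lemma exists_glue (hq : q ∈ Ioo (0 : ℝ) 1) {f₁ f₂ : ℝ → ℂ} (h₁ : MemLp f₁ 2 turn)
    (h₂ : MemLp f₂ 2 turn) : ∃ g : L2B q, (∀ᵐ t ∂turn, g (circlePt 1 t) = f₁ t) ∧
      ∀ᵐ t ∂turn, g (circlePt q t) = f₂ t := by
  obtain ⟨f₁', m₁, e₁⟩ := h₁.1
  obtain ⟨f₂', m₂, e₂⟩ := h₂.1
  set G : ℂ → ℂ := fun z => if ‖z‖ = 1 then f₁' (angle z) else f₂' (angle z) with hG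
  have hGm : StronglyMeasurable G :=
    StronglyMeasurable.ite (measurableSet_eq_fun measurable_norm measurable_const)
      (m₁.comp_measurable measurable_angle) (m₂.comp_measurable measurable_angle)
  have ht : ∀ᵐ t ∂turn, t ∈ Ico 0 (2 * Real.pi) := ae_restrict_mem measurableSet_Ico
  have E₁ : ∀ᵐ t ∂turn, G (circlePt 1 t) = f₁ t := by
    filter_upwards [ht, e₁] with t ht e
    simp only [hG]
    rw [norm_circlePt zero_le_one, if_pos rfl, angle_circlePt one_pos ht, e]
  have E₂ : ∀ᵐ t ∂turn, G (circlePt q t) = f₂ t := by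
    filter_upwards [ht, e₂] with t ht e
    simp only [hG]
    rw [norm_circlePt hq.1.le, if_neg hq.2.ne, angle_circlePt hq.1 ht, e]
  have hGL : MemLp G 2 (bdryMeasure q) := by
    rw [memLp_two_iff_integrable_sq_norm hGm.aestronglyMeasurable,
      integrable_bdry_iff (f := fun z => ‖G z‖ ^ 2) (hGm.aestronglyMeasurable.norm.pow 2)]
    refine ⟨((memLp_two_iff_integrable_sq_norm h₁.1).1 h₁).congr ?_,
      ((memLp_two_iff_integrable_sq_norm h₂.1).1 h₂).congr ?_⟩
    · filter_upwards [E₁] with t ht; rw [ht]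
    · filter_upwards [E₂] with t ht; rw [ht]
  obtain ⟨k₁, k₂⟩ := ae_bdry hGL.coeFn_toLp
  refine ⟨hGL.toLp, ?_, ?_⟩
  · filter_upwards [k₁, E₁] with t h h'; rw [h, h']
  · filter_upwards [k₂, E₂] with t h h'; rw [h, h']

lemma inner_L2B (x y : L2B q) : inner ℂ x y
    = ∫ t, y (circlePt 1 t) * (starRingEnd ℂ) (x (circlePt 1 t)) ∂turn
      + ∫ t, y (circlePt q t) * (starRingEnd ℂ) (x (circlePt q t)) ∂turn := by
  rw [L2.inner_def, integral_bdry (L2.integrable_inner (𝕜 := ℂ) x y)]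
  simp only [RCLike.inner_apply]

lemma exists_coverLimit_of_mem {α : ℝ} (hq : q ∈ Ioo (0 : ℝ) 1) {x : L2B q}
    (hx : x ∈ hardyBoundary q hq α) :
    ∃ F, CoverLimit q α F (fun t => x (circlePt 1 t)) (fun t => x (circlePt q t)) := by
  obtain ⟨F, hF, hb⟩ := hx
  exact ⟨F, hF, (memLp_comp x).1, (memLp_comp x).2, hb.outer, hb.inner⟩

lemma CoverLimit.mem_hardyBoundary {α : ℝ} (hq : q ∈ Ioo (0 : ℝ) 1) {F : ℝ → ℝ → ℂ}
    {f₁ f₂ : ℝ → ℂ} (h : CoverLimit q α F f₁ f₂) {g : L2B q}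
    (h₁ : ∀ᵐ t ∂turn, g (circlePt 1 t) = f₁ t) (h₂ : ∀ᵐ t ∂turn, g (circlePt q t) = f₂ t) :
    g ∈ hardyBoundary q hq α := by
  refine ⟨F, h.hardy, h.outer.congr fun r => eLpNorm_congr_ae ?_,
    h.inner.congr fun r => eLpNorm_congr_ae ?_⟩
  · filter_upwards [h₁] with t ht; rw [ht]
  · filter_upwards [h₂] with t ht; rw [ht]

/-- Orthogonality passes to the closure. Facts about `H2` are deduced below in this form, so the
closedness of `hardyBoundary` is never needed. -/
lemma inner_eq_zero_of_mem_H2 {α : ℝ} (hq : q ∈ Ioo (0 : ℝ) 1) {u : L2B q}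
    (h : ∀ x ∈ hardyBoundary q hq α, inner ℂ x u = 0) : ∀ x ∈ H2 q hq α, inner ℂ x u = 0 := by
  have : u ∈ (hardyBoundary q hq α)ᗮ := (Submodule.mem_orthogonal _ _).2 h
  rw [← Submodule.orthogonal_closure] at this
  exact (Submodule.mem_orthogonal _ _).1 this

lemma toeplitz_eq_smul_iff {α lam : ℝ} (hq : q ∈ Ioo (0 : ℝ) 1) (φ : LinftyB q)
    (g : H2 q hq α) : toeplitz q hq α φ g = (lam : ℂ) • g ↔
      ∀ x ∈ H2 q hq α, inner ℂ x (mulSymbol φ (g : L2B q) - (lam : ℂ) • (g : L2B q)) = 0 := by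
  have e : ((toeplitz q hq α φ g : H2 q hq α) : L2B q)
      = (H2 q hq α).starProjection (mulSymbol φ (g : L2B q)) := rfl
  rw [← Subtype.coe_inj, e, Submodule.coe_smul]
  constructor
  · intro h x hx
    rw [← h, ← inner_conj_symm, Submodule.starProjection_inner_eq_zero _ _ hx, map_zero]
  · intro h
    refine Submodule.eq_starProjection_of_mem_of_inner_eq_zero
      (Submodule.smul_mem _ _ g.2) fun x hx => ?_
    rw [← inner_conj_symm, h x hx, map_zero]

lemma inner_mulSymbol_sub {lam : ℝ} (φ : LinftyB q) (x g : L2B q) :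
    inner ℂ x (mulSymbol φ g - (lam : ℂ) • g)
      = ∫ t, ((φ (circlePt 1 t) - lam : ℝ) : ℂ) * g (circlePt 1 t)
          * (starRingEnd ℂ) (x (circlePt 1 t)) ∂turn
        + ∫ t, ((φ (circlePt q t) - lam : ℝ) : ℂ) * g (circlePt q t)
          * (starRingEnd ℂ) (x (circlePt q t)) ∂turn := by
  have h : ∀ᵐ z ∂bdryMeasure q, (mulSymbol φ g - (lam : ℂ) • g : L2B q) z
      = ((φ z - lam : ℝ) : ℂ) * g z := by
    filter_upwards [coeFn_mulSymbol φ g, Lp.coeFn_smul (lam : ℂ) g,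
      Lp.coeFn_sub (mulSymbol φ g) ((lam : ℂ) • g)] with z h1 h2 h3
    rw [h3, Pi.sub_apply, h1, h2, Pi.smul_apply, smul_eq_mul]
    push_cast; ring
  obtain ⟨h1, h2⟩ := ae_bdry h
  rw [inner_L2B]
  congr 1
  · refine integral_congr_ae ?_
    filter_upwards [h1] with t ht; rw [ht]
  · refine integral_congr_ae ?_
    filter_upwards [h2] with t ht; rw [ht]

end boundary

/-! ### The weight `(φ - λ)|g|²` of an eigenfunction. -/

variable {q : ℝ}

instance : IsFiniteMeasure (bdryMeasure q) := by
  unfold bdryMeasure circleMeasure; infer_instance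

instance : (ae turn).NeBot := by
  rw [ae_neBot]; intro h
  have := turn_univ
  rw [h] at this
  simp only [Measure.coe_zero, Pi.zero_apply] at this
  exact (ENNReal.ofReal_pos.2 Real.two_pi_pos).ne this

/-- Negative powers are allowed because the annulus avoids the origin; this is the source of the
rigidity of eigenfunctions. -/
lemma CoverLimit.mul_zpow {α : ℝ} (hq : q ∈ Ioo (0 : ℝ) 1) {F : ℝ → ℝ → ℂ} {f₁ f₂ : ℝ → ℂ}
    (h : CoverLimit q α F f₁ f₂) (n : ℤ) :
    CoverLimit q α (fun r t => F r t * circlePt r t ^ n) (fun t => f₁ t * circlePt 1 t ^ n)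
      (fun t => f₂ t * circlePt q t ^ n) := by
  obtain ⟨hq0, hq1⟩ := hq
  have hc : ∀ r, 0 < r → ∀ t, ContinuousAt (fun x : ℝ × ℝ => circlePt x.1 x.2 ^ n) (r, t) :=
    fun r hr t => continuous_circlePt_uncurry.continuousAt.zpow₀ n (Or.inl (by
      rw [← norm_ne_zero_iff, norm_circlePt hr.le]; exact hr.ne'))
  have hcc : ∀ r, 0 < r → Continuous fun t => circlePt r t ^ n := fun r hr =>
    continuous_of_continuousAt_uncurry (B := fun r t => circlePt r t ^ n) (hc r hr)
  have hmem : ∀ {f : ℝ → ℂ} {r : ℝ}, 0 < r → MemLp f 2 turn →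
      MemLp (fun t => f t * circlePt r t ^ n) 2 turn := fun {f r} hr hf => by
    refine MemLp.of_le_mul (c := r ^ n) hf (hf.1.mul (hcc r hr).aestronglyMeasurable) ?_
    refine Eventually.of_forall fun t => ?_
    rw [norm_mul, norm_zpow, norm_circlePt hr.le, mul_comm]
  have ev1 : ∀ᶠ r in 𝓝[<] (1 : ℝ), r ∈ Ioo q 1 := Ioo_mem_nhdsLT hq1
  have evq : ∀ᶠ r in 𝓝[>] q, r ∈ Ioo q 1 := Ioo_mem_nhdsGT hq1
  have hFm : ∀ r ∈ Ioo q 1, MemLp (F r) 2 turn := fun r hr =>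
    memLp_of_continuous (h.hardy.holo.continuous hq0 hr) 2
  refine ⟨⟨?_, ?_, ?_⟩, hmem one_pos h.memLp_outer, hmem hq0 h.memLp_inner, ?_, ?_⟩
  · have h1 : Differentiable ℂ fun w : ℂ => Complex.exp (n * w) := by fun_prop
    refine (h.hardy.holo.mul h1.differentiableOn).congr fun w _ => ?_
    have : circlePt (Real.exp w.re) w.im = Complex.exp w := by
      rw [circlePt_eq_exp (Real.exp_pos _), Real.log_exp, Complex.re_add_im]
    simp only [Pi.mul_apply, this, Complex.exp_int_mul]
  · intro r hr t
    simp only [h.hardy.index r hr, circlePt_add_two_pi]; ring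
  · obtain ⟨C, hC⟩ := h.hardy.bdd
    obtain ⟨M, hM⟩ := exists_bound_uncurry (B := fun r t => circlePt r t ^ n) (x := q) (y := 1)
      fun r hr => hc r (hq0.trans_le hr.1)
    refine ⟨M.toNNReal * C, fun r hr => ?_⟩
    refine (eLpNorm_mul_le_of_bound (hM r ⟨hr.1.le, hr.2.le⟩)).trans ?_
    push_cast
    exact mul_le_mul' le_rfl (hC r hr)
  · exact tendsto_eLpNorm_mul (B := fun r t => circlePt r t ^ n) nhdsWithin_le_nhds h.memLp_outer
      (ev1.mono hFm) (ev1.mono fun r hr => hcc r (hq0.trans hr.1)) (hcc 1 one_pos) (hc 1 one_pos)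
      h.outer
  · exact tendsto_eLpNorm_mul (B := fun r t => circlePt r t ^ n) nhdsWithin_le_nhds h.memLp_inner
      (evq.mono hFm) (evq.mono fun r hr => hcc r (hq0.trans hr.1)) (hcc q hq0) (hc q hq0)
      h.inner

lemma memLp_mul_conj_zpow (r : ℝ) {f : ℝ → ℂ} (hf : MemLp f 2 turn) (n : ℤ) :
    MemLp (fun t => f t * (starRingEnd ℂ) (circlePt r t ^ n)) 2 turn := by
  have := (memLp_mul_expi hf (-n)).const_mul ((r : ℂ) ^ n)
  refine this.ae_eq (Eventually.of_forall fun t => ?_)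
  simp only [circlePt_zpow, map_mul, conj_expi, map_zpow₀, Complex.conj_ofReal]
  ring

/-- If `u` is orthogonal to `H²_α`, then it is orthogonal to `z^n g` for every `g` in `H²_α`. -/
lemma integral_zpow_eq_zero {α : ℝ} (hq : q ∈ Ioo (0 : ℝ) 1) {u g : L2B q} (hg : g ∈ H2 q hq α)
    (hu : ∀ x ∈ H2 q hq α, inner ℂ x u = 0) (n : ℤ) :
    ∫ t, u (circlePt 1 t) * (starRingEnd ℂ) (g (circlePt 1 t)) * expi (-n) t ∂turn
      + (q : ℂ) ^ n *
        ∫ t, u (circlePt q t) * (starRingEnd ℂ) (g (circlePt q t)) * expi (-n) t ∂turn = 0 := by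
  -- The power of `z` is moved onto `u`: `v = u · conj (z^n)` is orthogonal to `hardyBoundary`,
  -- hence to its closure, which contains `g`.
  obtain ⟨v, hv₁, hv₂⟩ := exists_glue hq (memLp_mul_conj_zpow 1 (memLp_comp u).1 n)
    (memLp_mul_conj_zpow q (memLp_comp u).2 n)
  have key := inner_eq_zero_of_mem_H2 hq (α := α) (u := v) (fun x hx => by
    obtain ⟨F, hF⟩ := exists_coverLimit_of_mem hq hx
    have hF' := hF.mul_zpow hq n
    obtain ⟨y, hy₁, hy₂⟩ := exists_glue hq hF'.memLp_outer hF'.memLp_inner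
    rw [← hu y (Submodule.le_topologicalClosure _ (hF'.mem_hardyBoundary hq hy₁ hy₂)),
      inner_L2B, inner_L2B]
    congr 1
    · refine integral_congr_ae ?_
      filter_upwards [hv₁, hy₁] with t h1 h2
      rw [h1, h2, map_mul]; ring
    · refine integral_congr_ae ?_
      filter_upwards [hv₂, hy₂] with t h1 h2
      rw [h1, h2, map_mul]; ring) g hg
  rw [inner_L2B] at key
  rw [← key, ← integral_const_mul]
  congr 1
  · refine integral_congr_ae ?_
    filter_upwards [hv₁] with t h1
    rw [h1, circlePt_zpow, map_mul, conj_expi, map_zpow₀, Complex.conj_ofReal]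
    simp; ring
  · refine integral_congr_ae ?_
    filter_upwards [hv₂] with t h1
    rw [h1, circlePt_zpow, map_mul, conj_expi, map_zpow₀, Complex.conj_ofReal]
    ring

/-- The relation says that `g` is orthogonal to one fixed vector `v`, so it extends from
`hardyBoundary` to the closure. It ties the coefficients on the two circles by nonzero factors,
whence the uniqueness theorem `eq_zero_of_ae_eq_zero`. -/
lemma fourier_of_mem_H2 {α : ℝ} (hq : q ∈ Ioo (0 : ℝ) 1) {g : L2B q} (hg : g ∈ H2 q hq α)
    (n : ℤ) :
    ∫ t, g (circlePt 1 t) * Complex.exp (-(n + α) * (t * Complex.I)) ∂turn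
      = Complex.exp (-(n + α) * Real.log q) *
        ∫ t, g (circlePt q t) * Complex.exp (-(n + α) * (t * Complex.I)) ∂turn := by
  set E : ℝ → ℂ := fun t => Complex.exp (-(n + α) * (t * Complex.I)) with hE
  set κ : ℂ := Complex.exp (-(n + α) * Real.log q) with hκ
  have hEc : Continuous E := by simp only [hE]; fun_prop
  obtain ⟨v, hv₁, hv₂⟩ := exists_glue hq (memLp_conj (memLp_of_continuous hEc 2))
    (memLp_conj ((memLp_of_continuous hEc 2).const_mul (-κ)))
  have hinner : ∀ x : L2B q, inner ℂ x v = (starRingEnd ℂ)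
      (∫ t, x (circlePt 1 t) * E t ∂turn - κ * ∫ t, x (circlePt q t) * E t ∂turn) := by
    intro x
    rw [inner_L2B, map_sub, map_mul, ← integral_conj, ← integral_conj, sub_eq_add_neg, ← neg_mul,
      ← integral_const_mul]
    congr 1
    · refine integral_congr_ae ?_
      filter_upwards [hv₁] with t h1
      rw [h1, map_mul]; ring
    · refine integral_congr_ae ?_
      filter_upwards [hv₂] with t h1
      rw [h1, map_mul, map_mul, map_neg]; ring
  have key := inner_eq_zero_of_mem_H2 hq (α := α) (u := v) (fun x hx => by
    obtain ⟨F, hF⟩ := exists_coverLimit_of_mem hq hx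
    rw [hinner, hF.fourier hq n, sub_self, map_zero]) g hg
  rw [hinner, map_eq_zero] at key
  exact sub_eq_zero.1 key

lemma ae_eq_zero_of_twisted_fourier {f : ℝ → ℂ} (hf : MemLp f 2 turn) (α : ℝ)
    (h : ∀ n : ℤ, ∫ t, f t * Complex.exp (-(n + α) * (t * Complex.I)) ∂turn = 0) :
    ∀ᵐ t ∂turn, f t = 0 := by
  have hc : Continuous fun t : ℝ => Complex.exp (-α * (t * Complex.I)) := by fun_prop
  have h1 : Integrable (fun t => f t * Complex.exp (-α * (t * Complex.I))) turn :=
    hf.integrable_mul (memLp_of_continuous hc 2)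
  have h2 := ae_eq_zero_of_fourier h1 fun n => by
    rw [← h (-n)]
    congr 1; ext t
    rw [expi, mul_assoc, ← Complex.exp_add]
    congr 2; push_cast; ring
  filter_upwards [h2] with t ht
  exact (mul_eq_zero.1 ht).resolve_right (Complex.exp_ne_zero _)

/-- A function in `H²_α` vanishing almost everywhere on one boundary circle is zero. -/
lemma eq_zero_of_ae_eq_zero {α : ℝ} (hq : q ∈ Ioo (0 : ℝ) 1) {g : L2B q} (hg : g ∈ H2 q hq α)
    (h : (∀ᵐ t ∂turn, g (circlePt 1 t) = 0) ∨ ∀ᵐ t ∂turn, g (circlePt q t) = 0) : g = 0 := by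
  have hz : ∀ {f : ℝ → ℂ}, (∀ᵐ t ∂turn, f t = 0) → ∀ E : ℝ → ℂ, ∫ t, f t * E t ∂turn = 0 :=
    fun hf E => integral_eq_zero_of_ae (by
      filter_upwards [hf] with t ht; simp [ht])
  have hboth : (∀ᵐ t ∂turn, g (circlePt 1 t) = 0) ∧ ∀ᵐ t ∂turn, g (circlePt q t) = 0 := by
    rcases h with h | h
    · refine ⟨h, ae_eq_zero_of_twisted_fourier (memLp_comp g).2 α fun n => ?_⟩
      have := fourier_of_mem_H2 hq hg n
      rw [hz h] at this
      exact (mul_eq_zero.1 this.symm).resolve_left (Complex.exp_ne_zero _)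
    · refine ⟨ae_eq_zero_of_twisted_fourier (memLp_comp g).1 α fun n => ?_, h⟩
      rw [fourier_of_mem_H2 hq hg n, hz h, mul_zero]
  rw [Lp.eq_zero_iff_ae_eq_zero]
  exact ae_bdry_of (measurableSet_eq_fun (Lp.stronglyMeasurable g).measurable measurable_const)
    hboth.1 hboth.2

lemma logChi_outer (hq : 0 < q) (t : ℝ) : logChi q (circlePt 1 t) = -(1 / 2) * Real.log q := by
  rw [logChi, norm_circlePt zero_le_one, one_mul, Real.log_rpow hq]

lemma logChi_inner (hq : 0 < q) (t : ℝ) : logChi q (circlePt q t) = 1 / 2 * Real.log q := by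
  rw [logChi, norm_circlePt hq.le, Real.log_mul hq.ne' (Real.rpow_pos_of_pos hq _).ne',
    Real.log_rpow hq]
  ring

lemma measurable_logChi : Measurable (logChi q) := by
  unfold logChi
  exact Real.measurable_log.comp (measurable_norm.mul_const _)

lemma integrable_symbol_mul {lam : ℝ} (φ : LinftyB q) (g : L2B q) :
    Integrable (fun z => (φ z - lam) * ‖g z‖ ^ 2) (bdryMeasure q) := by
  have h := (L2.integrable_inner (𝕜 := ℂ) g (mulSymbol φ g - (lam : ℂ) • g)).re
  refine h.congr ?_
  filter_upwards [coeFn_mulSymbol φ g, Lp.coeFn_smul (lam : ℂ) g,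
    Lp.coeFn_sub (mulSymbol φ g) ((lam : ℂ) • g)] with z h1 h2 h3
  rw [h3, Pi.sub_apply, h1, h2, Pi.smul_apply, smul_eq_mul, RCLike.inner_apply]
  have : ((φ z : ℂ) * g z - lam * g z) * (starRingEnd ℂ) (g z)
      = (((φ z - lam) * ‖g z‖ ^ 2 : ℝ) : ℂ) := by
    push_cast
    rw [← Complex.mul_conj']; ring
  rw [this]
  exact Complex.ofReal_re _

/-- An eigenfunction `g` satisfies `(φ - λ)|g|² = c log|χ q^{-1/2}|` on the boundary. -/
lemma exists_weight_eq {α lam : ℝ} (hq : q ∈ Ioo (0 : ℝ) 1) (φ : LinftyB q) {g : H2 q hq α}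
    (hT : toeplitz q hq α φ g = (lam : ℂ) • g) :
    ∃ c : ℝ, ∀ᵐ z ∂bdryMeasure q,
      (φ z - lam) * ‖(g : L2B q) z‖ ^ 2 = c * logChi q z := by
  have hq0 := hq.1
  have hq1 := hq.2
  rw [toeplitz_eq_smul_iff] at hT
  set G : L2B q := (g : L2B q) with hG
  set u : L2B q := mulSymbol φ G - (lam : ℂ) • G with hu
  have hlog : Real.log q ≠ 0 := (Real.log_neg hq0 hq1).ne
  set h : ℂ → ℝ := fun z => (φ z - lam) * ‖G z‖ ^ 2 with hh
  have hint := integrable_symbol_mul (lam := lam) φ G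
  have hi := (integrable_bdry_iff hint.1).1 hint
  have hug : ∀ᵐ z ∂bdryMeasure q, u z * (starRingEnd ℂ) (G z) = (h z : ℂ) := by
    filter_upwards [coeFn_mulSymbol φ G, Lp.coeFn_smul (lam : ℂ) G,
      Lp.coeFn_sub (mulSymbol φ G) ((lam : ℂ) • G)] with z h1 h2 h3
    rw [hu, h3, Pi.sub_apply, h1, h2, Pi.smul_apply, smul_eq_mul, hh]
    push_cast
    rw [← Complex.mul_conj']; ring
  obtain ⟨hug₁, hug₂⟩ := ae_bdry hug
  set I₁ : ℤ → ℂ := fun n => ∫ t, (h (circlePt 1 t) : ℂ) * expi n t ∂turn with hI₁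
  set I₂ : ℤ → ℂ := fun n => ∫ t, (h (circlePt q t) : ℂ) * expi n t ∂turn with hI₂
  -- This is the orthogonality of `h` to `z^n`; since `h` is real, conjugating the relation for `-n`
  -- gives a second one, `rel'`, with `q^{-n}` in place of `q^n`.
  have rel : ∀ n : ℤ, I₁ (-n) + (q : ℂ) ^ n * I₂ (-n) = 0 := by
    intro n
    rw [← integral_zpow_eq_zero hq g.2 hT n]
    congr 1
    · refine integral_congr_ae ?_
      filter_upwards [hug₁] with t ht; rw [ht]
    · congr 1
      refine integral_congr_ae ?_
      filter_upwards [hug₂] with t ht; rw [ht]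
  have conj_rel : ∀ (f : ℝ → ℝ) (n : ℤ), (starRingEnd ℂ) (∫ t, (f t : ℂ) * expi n t ∂turn)
      = ∫ t, (f t : ℂ) * expi (-n) t ∂turn := fun f n => by
    rw [← integral_conj]; simp only [map_mul, Complex.conj_ofReal, conj_expi]
  have rel' : ∀ n : ℤ, I₁ (-n) + ((q : ℂ) ^ n)⁻¹ * I₂ (-n) = 0 := by
    intro n
    have := congrArg (starRingEnd ℂ) (rel (-n))
    rw [map_add, map_mul, map_zero, map_zpow₀, Complex.conj_ofReal, hI₁, hI₂,
      conj_rel (fun t => h (circlePt 1 t)), conj_rel (fun t => h (circlePt q t)), neg_neg, zpow_neg] at this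
    exact this
  have hz₂ : ∀ n : ℤ, 0 < n → I₂ n = 0 := by
    intro n hn
    have h1 := rel (-n)
    have h2 := rel' (-n)
    rw [neg_neg, zpow_neg] at h1 h2
    rw [inv_inv] at h2
    -- The factor is nonzero because `q^n < 1 < q^{-n}` for `n > 0`.
    have h3 : ((q : ℂ) ^ n - ((q : ℂ) ^ n)⁻¹) * I₂ n = 0 := by linear_combination h2 - h1
    refine (mul_eq_zero.1 h3).resolve_left fun h4 => ?_
    have h5 : (q ^ n : ℝ) < 1 := zpow_lt_one₀ hq0 hq1 hn
    have h6 : (0 : ℝ) < q ^ n := zpow_pos hq0 n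
    have h7 : q ^ n = (q ^ n)⁻¹ := by exact_mod_cast sub_eq_zero.1 h4
    have h8 : 1 < (q ^ n)⁻¹ := (one_lt_inv₀ h6).2 h5
    linarith
  have hz₁ : ∀ n : ℤ, 0 < n → I₁ n = 0 := by
    intro n hn
    have h1 := rel (-n)
    rw [neg_neg, hz₂ n hn, mul_zero, add_zero] at h1
    exact h1
  obtain ⟨c₁, hc₁, e₁⟩ := ae_eq_const_of_fourier hi.1 hz₁
  obtain ⟨c₂, hc₂, e₂⟩ := ae_eq_const_of_fourier hi.2 hz₂
  -- The relation for `n = 0`: the total integral of `h` over `B` is zero.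
  have hc : c₂ = -c₁ := by
    have h0 := rel 0
    simp only [hI₁, hI₂, neg_zero, zpow_zero, one_mul, expi_zero, mul_one] at h0
    rw [integral_complex_ofReal, integral_complex_ofReal] at h0
    have h0' : ∫ t, h (circlePt 1 t) ∂turn + ∫ t, h (circlePt q t) ∂turn = 0 := by
      exact_mod_cast h0
    rw [hc₁, hc₂]
    simp only [hh] at h0'
    linear_combination (2 * Real.pi)⁻¹ * h0'
  -- The denominator is the value of `logChi` on the outer circle; on the inner circle `logChi`
  -- takes the opposite value.
  refine ⟨c₁ / (-(1 / 2) * Real.log q), ae_bdry_of ?_ ?_ ?_⟩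
  · exact measurableSet_eq_fun (((Lp.stronglyMeasurable φ).measurable.sub_const _).mul
      ((Lp.stronglyMeasurable G).measurable.norm.pow_const 2)) (measurable_logChi.const_mul _)
  · filter_upwards [e₁] with t ht
    rw [logChi_outer hq0, ht]
    field_simp
  · filter_upwards [e₂] with t ht
    rw [logChi_inner hq0, ht, hc]
    field_simp

/-! ### The integrability criterion for eigenvalues. -/

lemma exists_ae_bound (φ : LinftyB q) : ∃ C : ℝ, ∀ᵐ z ∂bdryMeasure q, ‖φ z‖ ≤ C := by
  have h := (Lp.memLp φ).2
  refine ⟨(eLpNorm φ ∞ (bdryMeasure q)).toReal, ?_⟩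
  filter_upwards [ae_le_eLpNormEssSup (f := φ) (μ := bdryMeasure q)] with z hz
  rw [← eLpNorm_exponent_top] at hz
  rw [← toReal_enorm]
  exact ENNReal.toReal_mono h.ne hz

/-- The essential supremum is taken in `ℝ`, where it is meaningful only thanks to the essential
boundedness of `φ`. -/
lemma ae_le_essSup_of_le (φ : LinftyB q) {μ : Measure ℂ} (hμ : μ ≤ bdryMeasure q) :
    ∀ᵐ z ∂μ, φ z ≤ essSup φ μ := by
  obtain ⟨C, hC⟩ := exists_ae_bound φ
  exact ae_le_essSup ⟨C, (Measure.absolutelyContinuous_of_le hμ).ae_le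
    (hC.mono fun z hz => (le_abs_self _).trans hz)⟩

lemma ae_essInf_le_of_le (φ : LinftyB q) {μ : Measure ℂ} (hμ : μ ≤ bdryMeasure q) :
    ∀ᵐ z ∂μ, essInf φ μ ≤ φ z := by
  obtain ⟨C, hC⟩ := exists_ae_bound φ
  exact ae_essInf_le ⟨-C, (Measure.absolutelyContinuous_of_le hμ).ae_le
    (hC.mono fun z hz => (abs_le.1 hz).1)⟩

lemma circleMeasure_one_le : circleMeasure 1 ≤ bdryMeasure q := Measure.le_add_right le_rfl

lemma circleMeasure_inner_le : circleMeasure q ≤ bdryMeasure q := Measure.le_add_left le_rfl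

lemma ae_turn_of_ae_circleMeasure {r : ℝ} {p : ℂ → Prop} (h : ∀ᵐ z ∂circleMeasure r, p z) :
    ∀ᵐ t ∂turn, p (circlePt r t) :=
  ae_of_ae_map (continuous_circlePt r).measurable.aemeasurable h

lemma measurable_symbol (φ : LinftyB q) : Measurable φ := (Lp.stronglyMeasurable φ).measurable

lemma ae_abs_logChi (hq : q ∈ Ioo (0 : ℝ) 1) :
    ∀ᵐ z ∂bdryMeasure q, |logChi q z| = -(1 / 2) * Real.log q := by
  have hlog : Real.log q < 0 := Real.log_neg hq.1 hq.2
  refine ae_bdry_of (measurableSet_eq_fun measurable_logChi.abs measurable_const)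
    (Eventually.of_forall fun t => ?_) (Eventually.of_forall fun t => ?_)
  · rw [logChi_outer hq.1, abs_of_pos (by linarith)]
  · rw [logChi_inner hq.1, abs_of_neg (by linarith)]; ring

/-- If `φ - λ` has opposite constant signs on the two circles and `log|χ q^{-1/2}|/(φ - λ)` is
integrable, then `λ` is an eigenvalue. -/
lemma isEigenvalueRel_of_integrable (hq : q ∈ Ioo (0 : ℝ) 1) (φ : LinftyB q) {lam s : ℝ}
    (hs : s = 1 ∨ s = -1) (hsgn : ∀ᵐ z ∂bdryMeasure q, 0 ≤ s * ((φ z - lam) * logChi q z))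
    (hne : ∀ᵐ z ∂bdryMeasure q, φ z ≠ lam)
    (hint : Integrable (fun z => logChi q z / (φ z - lam)) (bdryMeasure q)) :
    IsEigenvalueRel q hq φ lam := by
  have hlog : Real.log q < 0 := Real.log_neg hq.1 hq.2
  set L : ℝ := -(1 / 2) * Real.log q with hL
  have hL0 : 0 < L := by rw [hL]; linarith
  obtain ⟨C, hC⟩ := exists_ae_bound φ
  have hs1 : |s| = 1 := by rcases hs with rfl | rfl <;> simp
  set D : ℝ := |C| + |lam| + 1 with hD
  have hD0 : 0 < D := by positivity
  have hw : Integrable (fun z => s * (logChi q z / (φ z - lam))) (bdryMeasure q) :=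
    hint.const_mul s
  -- The sign `s` makes the weight nonnegative. Its numerator has modulus `L` on both circles and
  -- its denominator is at most `|C| + |lam|`; the extra `1` in `D` only ensures `D > 0`.
  have hlow : ∀ᵐ z ∂bdryMeasure q, L / D ≤ s * (logChi q z / (φ z - lam)) := by
    filter_upwards [hC, hsgn, hne, ae_abs_logChi hq] with z h1 h2 h3 h4
    have h5 : φ z - lam ≠ 0 := sub_ne_zero.2 h3
    have e : s * (logChi q z / (φ z - lam))
        = s * ((φ z - lam) * logChi q z) / (φ z - lam) ^ 2 := by field_simp
    have h6 : 0 ≤ s * (logChi q z / (φ z - lam)) := by rw [e]; positivity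
    rw [← abs_of_nonneg h6, abs_mul, hs1, one_mul, abs_div, h4]
    refine div_le_div_of_nonneg_left hL0.le (abs_pos.2 h5) ?_
    have h7 : |φ z - lam| ≤ |φ z| + |lam| := abs_sub _ _
    have h8 : |φ z| ≤ |C| := h1.trans (le_abs_self C)
    rw [hD]; linarith
  obtain ⟨hlow₁, hlow₂⟩ := ae_bdry hlow
  obtain ⟨hne₁, hne₂⟩ := ae_bdry hne
  obtain ⟨hw₁, hw₂⟩ := (integrable_bdry_iff hw.1).1 hw
  obtain ⟨α, hα, F, F', f₁, f₂, f₁', f₂', hF, hF', h₁, h₂⟩ :=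
    exists_outer_annulus hq hw₁ hw₂ (div_pos hL0 hD0) hlow₁ hlow₂
  obtain ⟨g, hg₁, hg₂⟩ := exists_glue hq hF.memLp_outer hF.memLp_inner
  have hgm : g ∈ H2 q hq α :=
    Submodule.le_topologicalClosure _ (hF.mem_hardyBoundary hq hg₁ hg₂)
  -- Here `f'` is `1/g` and `(p - lam) |g|² = s l`, so the integrand `(φ - λ) g x̄` turns into the
  -- constant `s l` times the conjugate of `x/g`.
  have hpt : ∀ {l p : ℝ} {f f' g xt : ℂ}, p - lam ≠ 0 → g = f → f * f' = 1 →
      ‖f‖ ^ 2 = s * (l / (p - lam)) → ((p - lam : ℝ) : ℂ) * g * (starRingEnd ℂ) xt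
        = ((s * l : ℝ) : ℂ) * (starRingEnd ℂ) (xt * f') := by
    intro l p f f' g xt hp hgf hff' hn
    have h3 : f * (starRingEnd ℂ) f = ((s * (l / (p - lam)) : ℝ) : ℂ) := by
      rw [Complex.mul_conj', ← hn]; push_cast; rfl
    have h4 : (starRingEnd ℂ) f * (starRingEnd ℂ) f' = 1 := by rw [← map_mul, hff', map_one]
    have h5 : ((s * l : ℝ) : ℂ) = ((p - lam : ℝ) : ℂ) * ((s * (l / (p - lam)) : ℝ) : ℂ) := by
      rw [← Complex.ofReal_mul]; congr 1; field_simp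
    rw [h5, ← h3, hgf, map_mul]
    linear_combination (-((p - lam : ℝ) : ℂ) * f * (starRingEnd ℂ) xt) * h4
  refine ⟨α, hα, ⟨g, hgm⟩, ?_, ?_⟩
  · intro h0
    have h0' : g = 0 := congrArg Subtype.val h0
    have hz := (ae_bdry (Lp.coeFn_zero ℂ 2 (bdryMeasure q))).1
    obtain ⟨t, ht1, ht2, ht3⟩ := (hz.and (hg₁.and h₁)).exists
    rw [h0', ht1] at ht2
    have := ht3.1
    rw [← ht2, Pi.zero_apply, zero_mul] at this
    exact zero_ne_one this
  · rw [toeplitz_eq_smul_iff]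
    refine inner_eq_zero_of_mem_H2 hq fun x hx => ?_
    obtain ⟨X, hX⟩ := exists_coverLimit_of_mem hq hx
    have hpair := integral_mul_eq_of_coverLimit hq hX hF'
    rw [inner_mulSymbol_sub]
    have e₁ : ∫ t, ((φ (circlePt 1 t) - lam : ℝ) : ℂ) * g (circlePt 1 t)
          * (starRingEnd ℂ) (x (circlePt 1 t)) ∂turn
        = ((s * L : ℝ) : ℂ) * (starRingEnd ℂ) (∫ t, x (circlePt 1 t) * f₁' t ∂turn) := by
      rw [← integral_conj, ← integral_const_mul]
      refine integral_congr_ae ?_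
      filter_upwards [hne₁, hg₁, h₁] with t k1 k2 k3
      rw [logChi_outer hq.1] at k3
      exact hpt (sub_ne_zero.2 k1) k2 k3.1 k3.2
    have e₂ : ∫ t, ((φ (circlePt q t) - lam : ℝ) : ℂ) * g (circlePt q t)
          * (starRingEnd ℂ) (x (circlePt q t)) ∂turn
        = ((s * -L : ℝ) : ℂ) * (starRingEnd ℂ) (∫ t, x (circlePt q t) * f₂' t ∂turn) := by
      rw [← integral_conj, ← integral_const_mul]
      refine integral_congr_ae ?_
      filter_upwards [hne₂, hg₂, h₂] with t k1 k2 k3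
      have hLq : 1 / 2 * Real.log q = -L := by rw [hL]; ring
      rw [logChi_inner hq.1, hLq] at k3
      exact hpt (sub_ne_zero.2 k1) k2 k3.1 k3.2
    change (∫ t, ((φ (circlePt 1 t) - lam : ℝ) : ℂ) * g (circlePt 1 t)
          * (starRingEnd ℂ) (x (circlePt 1 t)) ∂turn) + (∫ t, ((φ (circlePt q t) - lam : ℝ) : ℂ)
          * g (circlePt q t) * (starRingEnd ℂ) (x (circlePt q t)) ∂turn) = 0
    -- The means of `x/g` on the two circles agree while the constants `s L` and `-s L` are
    -- opposite.
    rw [e₁, e₂, hpair]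
    push_cast; ring

/-- If `φ - λ` does not vanish on one of the circles, the weight of an eigenfunction is a nonzero
multiple of `log|χ q^{-1/2}|`. -/
lemma exists_weight_eq_ne_zero {α lam : ℝ} (hq : q ∈ Ioo (0 : ℝ) 1) (φ : LinftyB q)
    {g : H2 q hq α} (hg : g ≠ 0) (hT : toeplitz q hq α φ g = (lam : ℂ) • g)
    (hne : (∀ᵐ t ∂turn, φ (circlePt 1 t) ≠ lam) ∨ ∀ᵐ t ∂turn, φ (circlePt q t) ≠ lam) :
    ∃ c : ℝ, c ≠ 0 ∧ ∀ᵐ z ∂bdryMeasure q,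
      (φ z - lam) * ‖(g : L2B q) z‖ ^ 2 = c * logChi q z := by
  obtain ⟨c, hc⟩ := exists_weight_eq hq φ hT
  refine ⟨c, ?_, hc⟩
  rintro rfl
  refine hg (Subtype.ext (eq_zero_of_ae_eq_zero hq g.2 ?_))
  obtain ⟨h₁, h₂⟩ := ae_bdry hc
  have hpt : ∀ z : ℂ, φ z ≠ lam → (φ z - lam) * ‖(g : L2B q) z‖ ^ 2 = 0 * logChi q z →
      (g : L2B q) z = 0 := fun z hz h => by
    rw [zero_mul] at h
    simpa using (mul_eq_zero.1 h).resolve_left (sub_ne_zero.2 hz)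
  rcases hne with h | h
  · left; filter_upwards [h, h₁] with t k1 k2 using hpt _ k1 k2
  · right; filter_upwards [h, h₂] with t k1 k2 using hpt _ k1 k2

/-- Where `φ = λ` the weight equation would force `logChi` to vanish, which it does not on `B`;
elsewhere the quotient is `|g|²/c`. -/
lemma integrable_of_isEigenvalueRel {lam : ℝ} (hq : q ∈ Ioo (0 : ℝ) 1) (φ : LinftyB q)
    (hne : (∀ᵐ t ∂turn, φ (circlePt 1 t) ≠ lam) ∨ ∀ᵐ t ∂turn, φ (circlePt q t) ≠ lam)
    (h : IsEigenvalueRel q hq φ lam) :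
    (∀ᵐ z ∂bdryMeasure q, φ z ≠ lam) ∧
      Integrable (fun z => logChi q z / (φ z - lam)) (bdryMeasure q) := by
  obtain ⟨α, -, g, hg, hT⟩ := h
  obtain ⟨c, hc0, hc⟩ := exists_weight_eq_ne_zero hq φ hg hT hne
  have hlog : Real.log q < 0 := Real.log_neg hq.1 hq.2
  have hφ : ∀ᵐ z ∂bdryMeasure q, φ z ≠ lam := by
    filter_upwards [hc, ae_abs_logChi hq] with z h1 h2 h3
    rw [h3, sub_self, zero_mul] at h1
    have h4 : logChi q z = 0 := (mul_eq_zero.1 h1.symm).resolve_left hc0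
    rw [h4, abs_zero] at h2
    linarith
  refine ⟨hφ, ?_⟩
  have hi : Integrable (fun z => c⁻¹ * ‖(g : L2B q) z‖ ^ 2) (bdryMeasure q) :=
    ((memLp_two_iff_integrable_sq_norm (Lp.aestronglyMeasurable _)).1
      (Lp.memLp (g : L2B q))).const_mul _
  refine hi.congr ?_
  filter_upwards [hφ, hc] with z h1 h2
  have h3 : φ z - lam ≠ 0 := sub_ne_zero.2 h1
  field_simp
  linarith

end AnnulusToeplitz

end

/-! ### The corollary. -/

open AnnulusToeplitz in
theorem corollary2p2 (q : ℝ) (hq : q ∈ Set.Ioo (0 : ℝ) 1) (φ : AnnulusToeplitz.LinftyB q)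
    (m M : ℝ) (hm : m < 0) (hM : 0 < M)
    (hφ :
      (essSup φ (AnnulusToeplitz.circleMeasure q) = m ∧
        essInf φ (AnnulusToeplitz.circleMeasure 1) = M) ∨
      (essSup φ (AnnulusToeplitz.circleMeasure 1) = m ∧
        essInf φ (AnnulusToeplitz.circleMeasure q) = M)) :
    (∀ lam ∈ Set.Ioo m M, AnnulusToeplitz.IsEigenvalueRel q hq φ lam) ∧
    ((essSup φ (AnnulusToeplitz.circleMeasure 1) = m ∧
        essInf φ (AnnulusToeplitz.circleMeasure q) = M) →
      ∀ lam ∈ Set.Ioo m M, ∀ α ∈ Set.Ico (0 : ℝ) 1, ∀ g : AnnulusToeplitz.H2 q hq α,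
        g ≠ 0 → AnnulusToeplitz.toeplitz q hq α φ g = (lam : ℂ) • g →
        ∃ c : ℝ, c < 0 ∧
          ∀ᵐ z ∂(AnnulusToeplitz.bdryMeasure q),
            (φ z - lam) * ‖(g : AnnulusToeplitz.L2B q) z‖ ^ 2 =
              c * AnnulusToeplitz.logChi q z) ∧
    (AnnulusToeplitz.IsEigenvalueRel q hq φ M ↔
      (∀ᵐ z ∂(AnnulusToeplitz.bdryMeasure q), φ z ≠ M) ∧
        Integrable (fun z => AnnulusToeplitz.logChi q z / (φ z - M))
          (AnnulusToeplitz.bdryMeasure q)) ∧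
    (AnnulusToeplitz.IsEigenvalueRel q hq φ m ↔
      (∀ᵐ z ∂(AnnulusToeplitz.bdryMeasure q), φ z ≠ m) ∧
        Integrable (fun z => AnnulusToeplitz.logChi q z / (φ z - m))
          (AnnulusToeplitz.bdryMeasure q)) := by
  have hlog : Real.log q < 0 := Real.log_neg hq.1 hq.2
  have hmM : m < M := hm.trans hM
  have hsup₁ := ae_turn_of_ae_circleMeasure (ae_le_essSup_of_le φ circleMeasure_one_le)
  have hsup₂ := ae_turn_of_ae_circleMeasure (ae_le_essSup_of_le φ circleMeasure_inner_le)
  have hinf₁ := ae_turn_of_ae_circleMeasure (ae_essInf_le_of_le φ circleMeasure_one_le)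
  have hinf₂ := ae_turn_of_ae_circleMeasure (ae_essInf_le_of_le φ circleMeasure_inner_le)
  have hne : ∀ lam ∈ Icc m M,
      (∀ᵐ t ∂turn, φ (circlePt 1 t) ≠ lam) ∨ ∀ᵐ t ∂turn, φ (circlePt q t) ≠ lam := by
    intro lam hlam
    -- For `λ = M` the circle with `φ ≤ m` is used, for `λ < M` the one with `φ ≥ M`; one circle
    -- suffices, so the endpoints are included.
    rcases eq_or_lt_of_le hlam.2 with h | h
    · rcases hφ with ⟨h1, -⟩ | ⟨h1, -⟩
      · right; filter_upwards [hsup₂] with t ht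
        rw [h1] at ht; exact (ht.trans_lt (hmM.trans_eq h.symm)).ne
      · left; filter_upwards [hsup₁] with t ht
        rw [h1] at ht; exact (ht.trans_lt (hmM.trans_eq h.symm)).ne
    · rcases hφ with ⟨-, h1⟩ | ⟨-, h1⟩
      · left; filter_upwards [hinf₁] with t ht
        rw [h1] at ht; exact (h.trans_le ht).ne'
      · right; filter_upwards [hinf₂] with t ht
        rw [h1] at ht; exact (h.trans_le ht).ne'
  have hmeas : ∀ s lam : ℝ, MeasurableSet {z | 0 ≤ s * ((φ z - lam) * logChi q z)} := fun s lam =>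
    measurableSet_le measurable_const
      ((((measurable_symbol φ).sub_const _).mul measurable_logChi).const_mul _)
  -- `logChi` is positive on the outer circle and negative on the inner one, so `s = 1` fits case
  -- (i) and `s = -1` case (ii).
  have hsgn : ∃ s : ℝ, (s = 1 ∨ s = -1) ∧ ∀ lam ∈ Icc m M,
      ∀ᵐ z ∂bdryMeasure q, 0 ≤ s * ((φ z - lam) * logChi q z) := by
    rcases hφ with ⟨h1, h2⟩ | ⟨h1, h2⟩
    · refine ⟨1, Or.inl rfl, fun lam hlam => ae_bdry_of (hmeas 1 lam) ?_ ?_⟩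
      · filter_upwards [hinf₁] with t ht
        rw [h2] at ht
        rw [logChi_outer hq.1]
        have := mul_nonneg (sub_nonneg.2 (hlam.2.trans ht)) (neg_nonneg.2 hlog.le)
        linarith
      · filter_upwards [hsup₂] with t ht
        rw [h1] at ht
        rw [logChi_inner hq.1]
        have := mul_nonneg (sub_nonneg.2 (ht.trans hlam.1)) (neg_nonneg.2 hlog.le)
        linarith
    · refine ⟨-1, Or.inr rfl, fun lam hlam => ae_bdry_of (hmeas (-1) lam) ?_ ?_⟩
      · filter_upwards [hsup₁] with t ht
        rw [h1] at ht
        rw [logChi_outer hq.1]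
        have := mul_nonneg (sub_nonneg.2 (ht.trans hlam.1)) (neg_nonneg.2 hlog.le)
        linarith
      · filter_upwards [hinf₂] with t ht
        rw [h2] at ht
        rw [logChi_inner hq.1]
        have := mul_nonneg (sub_nonneg.2 (hlam.2.trans ht)) (neg_nonneg.2 hlog.le)
        linarith
  obtain ⟨s, hs, hsgn⟩ := hsgn
  have hiff : ∀ lam ∈ Icc m M, IsEigenvalueRel q hq φ lam ↔
      (∀ᵐ z ∂bdryMeasure q, φ z ≠ lam) ∧
        Integrable (fun z => logChi q z / (φ z - lam)) (bdryMeasure q) := fun lam hlam =>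
    ⟨integrable_of_isEigenvalueRel hq φ (hne lam hlam), fun h =>
      isEigenvalueRel_of_integrable hq φ hs (hsgn lam hlam) h.1 h.2⟩
  refine ⟨fun lam hlam => ?_, ?_, hiff M ⟨hmM.le, le_rfl⟩, hiff m ⟨le_rfl, hmM.le⟩⟩
  -- For interior `λ` the values of `φ` stay at distance at least `δ` from `λ`, so the quotient in
  -- the criterion is bounded.
  · set δ := min (lam - m) (M - lam) with hδ
    have hδ0 : 0 < δ := lt_min (sub_pos.2 hlam.1) (sub_pos.2 hlam.2)
    have hgap : ∀ᵐ z ∂bdryMeasure q, δ ≤ |φ z - lam| := by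
      have hlow : ∀ x, x ≤ m → δ ≤ |x - lam| := fun x hx => by
        rw [abs_sub_comm]
        exact (min_le_left _ _).trans (le_trans (by linarith) (le_abs_self _))
      have hhigh : ∀ x, M ≤ x → δ ≤ |x - lam| := fun x hx =>
        (min_le_right _ _).trans (le_trans (by linarith) (le_abs_self _))
      have hms : MeasurableSet {z | δ ≤ |φ z - lam|} :=
        measurableSet_le measurable_const ((measurable_symbol φ).sub_const _).abs
      rcases hφ with ⟨h1, h2⟩ | ⟨h1, h2⟩
      · rw [h2] at hinf₁; rw [h1] at hsup₂
        exact ae_bdry_of hms (hinf₁.mono fun t => hhigh _) (hsup₂.mono fun t => hlow _)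
      · rw [h1] at hsup₁; rw [h2] at hinf₂
        exact ae_bdry_of hms (hsup₁.mono fun t => hlow _) (hinf₂.mono fun t => hhigh _)
    refine (hiff lam ⟨hlam.1.le, hlam.2.le⟩).2 ⟨?_, ?_⟩
    · filter_upwards [hgap] with z hz h
      rw [h, sub_self, abs_zero] at hz
      linarith
    · refine Integrable.of_bound (measurable_logChi.div
        ((measurable_symbol φ).sub_const _)).aestronglyMeasurable
        (-(1 / 2) * Real.log q / δ) ?_
      filter_upwards [hgap, ae_abs_logChi hq] with z h1 h2
      rw [Real.norm_eq_abs, abs_div, h2]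
      exact div_le_div_of_nonneg_left (by linarith) hδ0 h1
  · rintro ⟨h1, -⟩ lam hlam α - g hg hT
    obtain ⟨c, hc0, hc⟩ := exists_weight_eq_ne_zero hq φ hg hT (hne lam ⟨hlam.1.le, hlam.2.le⟩)
    refine ⟨c, lt_of_le_of_ne ?_ hc0, hc⟩
    -- One point of the outer circle decides the sign: there `φ ≤ m < λ` makes the left side
    -- nonpositive, while `logChi` is positive.
    obtain ⟨t, ht1, ht2⟩ := (hsup₁.and (ae_bdry hc).1).exists
    rw [h1] at ht1
    rw [logChi_outer hq.1] at ht2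
    have h3 : 0 ≤ (lam - φ (circlePt 1 t)) * ‖(g : L2B q) (circlePt 1 t)‖ ^ 2 :=
      mul_nonneg (by linarith [hlam.1]) (by positivity)
    by_contra hcpos
    have h4 : 0 < c * (-(1 / 2) * Real.log q) := mul_pos (not_le.1 hcpos) (by linarith)
    linarith
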